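/- **Setting.** Floating-point arithmetic follows the standard model with unit roundoff $\epsilon>0$, without overflow and underflow: each computed $+,-,\cdot,/$ and $\sqrt{\ }$ equals its exact value times $1+\delta$ with $|\delta|\le\epsilon$; sign changes, absolute values, comparisons and multiplication by $0,\pm1$ are exact. $\|\cdot\|$ is the spectral norm, $|X|$ the entrywise absolute value, $\operatorname{adj}$ the adjugate, $J=\begin{bmatrix}0&1\\-1&0\end{bmatrix}$. $\mathrm{xLARTG}(f,g)$ and $\mathrm{xLASV2}$ are the LAPACK routines, executed in this arithmetic: the former computes $(f,g)/\sqrt{f^2+g^2}$ up to a common sign, the latter computes rotations $U,V$ such that $V^TMU$ is diagonal for an upper-triangular $2\times2$ matrix $M$. **Algorithm RSVD22.** Input: real upper-triangular $2\times 2$ matrices $A,B,C$, with $A$ nonsingular. Everything is evaluated in floating-point arithmetic; bars denote computed quantities. 1. If $c_{11}=b_{22}=0$: set $P=Q=J$, compute with xLARTG rotations $V,U$ with $(V^TC)_{22}=0$ and $(BU)_{11}=0$, let $A'=P^TAQ$, $B'=P^TBU$, $C'=V^TCQ$, $b'_{21}=c'_{21}=0$, and stop. (Here put $\overline\eta_{\max}=1$.)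 2. Compute $M=C\operatorname{adj}(A)B$ with $m_{11}=(c_{11}a_{22})b_{11}$, $m_{21}=0$, $m_{22}=c_{22}(a_{11}b_{22})$, $m_{12}=\bigl((c_{11}a_{22})b_{12}+c_{12}(a_{11}b_{22})\bigr)-(c_{11}a_{12})b_{22}$, evaluated as parenthesized, and $U,V$ from $M$ with xLASV2. If $c_{11},c_{22},b_{11},b_{22}$ are all nonzero and $\max\{|u_{11}|,|v_{11}|\}<\max\{|u_{12}|,|v_{12}|\}$, replace $U,V$ by $UJ,VJ$. 3. Compute $G=V^TC$ (optionally set $g_{22}=0$ if $c_{11}=0$), $L=BU$ (optionally set $l_{12}=0$ if $b_{22}=0$), $H=\operatorname{adj}(A)L$, $K=G\operatorname{adj}(A)$, $\widehat G=|V|^T|C|$, $\widehat L=|B||U|$, $\widehat H=|\operatorname{adj}(A)|\widehat L$, $\widehat K=\widehat G|\operatorname{adj}(A)|$, and $$\eta_g=\frac{\widehat g_{11}+\widehat g_{12}}{|g_{11}|+|g_{12}|},\quad \eta_h=\frac{\widehat h_{12}+\widehat h_{22}}{|h_{12}|+|h_{22}|},\quad \eta_k=\frac{\widehat k_{11}+\widehat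 k_{12}}{|k_{11}|+|k_{12}|},\quad \eta_l=\frac{\widehat l_{12}+\widehat l_{22}}{|l_{12}|+|l_{22}|},$$ where a quotient with zero denominator is $\infty$. Let $\eta_{\max}=\max\{1,\min\{\eta_g,\eta_h\},\min\{\eta_k,\eta_l\}\}$. 4. If $|h_{12}|+|h_{22}|=0$, or $|g_{11}|+|g_{12}|\ne0$ and $\eta_g\le\eta_h$, compute with xLARTG a rotation $Q$ such that $(GQ)_{12}=0$; otherwise one such that $(Q^TH)_{12}=0$. Similarly, if $|k_{11}|+|k_{12}|=0$, or $|l_{12}|+|l_{22}|\ne0$ and $\eta_l\le\eta_k$, compute with xLARTG a rotation $P$ such that $(P^TL)_{12}=0$; otherwise one such that $(KP)_{12}=0$. 5. Let $A'=P^TAQ$, $B'=P^TL$, $C'=GQ$ and set $a'_{12}=b'_{12}=c'_{12}=0$. Products of three matrices in steps 1 and 5 may be evaluated in either order. **Theorem.** There is an absolute constant $c>0$ such that the following holds for all $\epsilon>0$, all floating-point arithmetics as above, all inputs $A,B,C$, and all choices of the options. If the computed $\overline\eta_{\max}$ is finite and $171\,\epsilon\,\overline\eta_{\max}\le c$, then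 there exist (exactly) orthogonal matrices $\mathcal P,\mathcal Q$ and a matrix $\delta A$ such that $$\overline A'=\mathcal P(A+\delta A)\mathcal Q,\qquad \|\delta A\|\le(44.5+342\,\overline\eta_{\max})\,\epsilon\,\|A\|.$$ -/

import Mathlib

open scoped Matrix
open scoped Matrix.Norms.L2Operator

noncomputable section

/-- Floating-point arithmetic obeying the standard model with unit roundoff `u`, without
overflow and underflow: `fl (a ∘ b) = (a ∘ b) (1 + δ)` with `|δ| ≤ u` for the four basic operations
and the square root.  Multiplication by `1` and `-1` is exact (so is multiplication by `0`, by
`mul_spec`).  Sign changes, absolute values and comparisons are exact and need no operation here.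
The operations are total functions on the reals: on arguments that are not floating-point numbers
they may be taken to be the exact ones. -/
structure FloatArith where
  /-- the unit roundoff -/
  u : ℝ
  u_pos : 0 < u
  add : ℝ → ℝ → ℝ
  sub : ℝ → ℝ → ℝ
  mul : ℝ → ℝ → ℝ
  div : ℝ → ℝ → ℝ
  sqrt : ℝ → ℝ
  add_spec : ∀ a b, ∃ δ, |δ| ≤ u ∧ add a b = (a + b) * (1 + δ)
  sub_spec : ∀ a b, ∃ δ, |δ| ≤ u ∧ sub a b = (a - b) * (1 + δ)
  mul_spec : ∀ a b, ∃ δ, |δ| ≤ u ∧ mul a b = (a * b) * (1 + δ)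
  div_spec : ∀ a b, b ≠ 0 → ∃ δ, |δ| ≤ u ∧ div a b = (a / b) * (1 + δ)
  sqrt_spec : ∀ a, 0 ≤ a → ∃ δ, |δ| ≤ u ∧ sqrt a = Real.sqrt a * (1 + δ)
  mul_one : ∀ a, mul a 1 = a
  one_mul : ∀ a, mul 1 a = a
  mul_neg_one : ∀ a, mul a (-1) = -a
  neg_one_mul : ∀ a, mul (-1) a = -a

/-- Real `2 × 2` matrices. -/
abbrev Mat2 : Type := Matrix (Fin 2) (Fin 2) ℝ

/-- `rot(c, s) = [c s; -s c]`. -/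
def rot (c s : ℝ) : Mat2 := !![c, s; -s, c]

/-- The matrix `J = rot(π/2)`.  Multiplication by it only permutes entries and changes signs. -/
def rotJ : Mat2 := !![0, 1; -1, 0]

/-- Entrywise absolute value. -/
def matAbs (X : Mat2) : Mat2 := Matrix.of fun i j => |X i j|

/-- The matrix `X` with its `(i, j)` entry replaced by zero (indices start at `0`). -/
def zeroEntry (X : Mat2) (i j : Fin 2) : Mat2 :=
  Matrix.of fun k l => if k = i ∧ l = j then 0 else X k l

/-- The transfer of sign `SIGN(a, b)`: the absolute value of `a` with the sign of `b`. -/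
def signTransfer (a b : ℝ) : ℝ := if 0 ≤ b then |a| else -|a|

namespace FloatArith

variable (F : FloatArith)

/-- The computed matrix product `fl(XY)`. -/
def matMul (X Y : Mat2) : Mat2 :=
  Matrix.of fun i j => F.add (F.mul (X i 0) (Y 0 j)) (F.mul (X i 1) (Y 1 j))

/-- The computed product of three matrices, either `fl(fl(XY)Z)` or `fl(X fl(YZ))`. -/
def matMul₃ (leftFirst : Bool) (X Y Z : Mat2) : Mat2 :=
  if leftFirst then F.matMul (F.matMul X Y) Z else F.matMul X (F.matMul Y Z)

/-- The LAPACK routine `xLARTG` (its rescaling against overflow and underflow left out):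
the pair `(c, s)` computed for `c = f / √(f² + g²)` and `s = g / √(f² + g²)`, up to a common sign. -/
def lartg (f g : ℝ) : ℝ × ℝ :=
  if g = 0 then (1, 0)
  else if f = 0 then (0, 1)
  else
    let r := F.sqrt (F.add (F.mul f f) (F.mul g g))
    let c := F.div f r
    let s := F.div g r
    if |g| < |f| ∧ c < 0 then (-c, -s) else (c, s)

/-- The core of the LAPACK routine `xLASV2` for `[f g; 0 h]` with `|h| ≤ |f|`; it returns
`(clt, slt, crt, srt)`.  The machine precision that the routine asks for is the unit roundoff. -/
def lasv2Core (f g h : ℝ) : ℝ × ℝ × ℝ × ℝ :=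
  if g = 0 then (1, 0, 1, 0)
  else if |f| < |g| ∧ F.div |f| |g| < F.u then
    (1, F.div h g, F.div f g, 1)
  else
    let d := F.sub |f| |h|
    let l := if d = |f| then 1 else F.div d |f|
    let m := F.div g f
    let t := F.sub 2 l
    let mm := F.mul m m
    let tt := F.mul t t
    let s := F.sqrt (F.add tt mm)
    let r := if l = 0 then |m| else F.sqrt (F.add (F.mul l l) mm)
    let a := F.mul (1 / 2) (F.add s r)
    let t' :=
      if mm = 0 then
        if l = 0 then F.mul (signTransfer 2 f) (signTransfer 1 g)
        else F.add (F.div g (signTransfer d f)) (F.div m t)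
      else F.mul (F.add (F.div m (F.add s t)) (F.div m (F.add r l))) (F.add 1 a)
    let l' := F.sqrt (F.add (F.mul t' t') 4)
    let crt := F.div 2 l'
    let srt := F.div t' l'
    let clt := F.div (F.add crt (F.mul srt m)) a
    let slt := F.div (F.mul (F.div h f) srt) a
    (clt, slt, crt, srt)

/-- The LAPACK routine `xLASV2` for the upper-triangular matrix `[f g; 0 h]`; it returns
`(csl, snl, csr, snr)` such that, up to rounding,
`[csl snl; -snl csl] * [f g; 0 h] * [csr -snr; snr csr]` is diagonal.  The singular values that the
routine also returns are not needed. -/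
def lasv2 (f g h : ℝ) : ℝ × ℝ × ℝ × ℝ :=
  if |f| < |h| then
    let (clt, slt, crt, srt) := F.lasv2Core h g f
    (srt, crt, slt, clt)
  else F.lasv2Core f g h

/-- The computed product `M = C adj(A) B` of upper-triangular matrices. -/
def prodM (A B C : Mat2) : Mat2 :=
  let ca := F.mul (C 0 0) (A 1 1)
  let ab := F.mul (A 0 0) (B 1 1)
  !![F.mul ca (B 0 0),
     F.sub (F.add (F.mul ca (B 0 1)) (F.mul (C 0 1) ab)) (F.mul (F.mul (C 0 0) (A 0 1)) (B 1 1));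
     0, F.mul (C 1 1) ab]

/-- The computed quotient `(n₁ + n₂) / (|d₁| + |d₂|)`, which is `∞` if the denominator is zero. -/
def eta (n₁ n₂ d₁ d₂ : ℝ) : EReal :=
  let den := F.add |d₁| |d₂|
  if den = 0 then ⊤ else ((F.div (F.add n₁ n₂) den : ℝ) : EReal)

end FloatArith

/-- The choices that the algorithm leaves open. -/
structure RSVD22Options where
  /-- set `g₂₂` to zero if `c₁₁ = 0` -/
  zeroG : Bool
  /-- set `l₁₂` to zero if `b₂₂ = 0` -/
  zeroL : Bool
  /-- evaluate products of three matrices from left to right -/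
  leftFirst : Bool

/-- The computed output of the algorithm, and the computed `η_max`. -/
structure RSVD22Output where
  P : Mat2
  Q : Mat2
  U : Mat2
  V : Mat2
  A' : Mat2
  B' : Mat2
  C' : Mat2
  etaMax : EReal

/-- The branch of `RSVD22` for `c₁₁ = b₂₂ = 0`.  No `η` is computed here; `etaMax` gets its
least possible value `1`. -/
def rsvd22Special (F : FloatArith) (opt : RSVD22Options) (A B C : Mat2) : RSVD22Output :=
  let (cv, sv) := F.lartg (C 0 1) (C 1 1)
  let V := rot cv (-sv)
  let (cu, su) := F.lartg (B 0 1) (-B 0 0)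
  let U := rot cu (-su)
  { P := rotJ
    Q := rotJ
    U := U
    V := V
    A' := F.matMul₃ opt.leftFirst rotJᵀ A rotJ
    B' := zeroEntry (F.matMul₃ opt.leftFirst rotJᵀ B U) 1 0
    C' := zeroEntry (F.matMul₃ opt.leftFirst Vᵀ C rotJ) 1 0
    etaMax := 1 }

/-- The part of `RSVD22` that follows the computation of `U` and `V`. -/
def rsvd22Finish (F : FloatArith) (opt : RSVD22Options) (A B C U V : Mat2) : RSVD22Output :=
  let adjA := A.adjugate
  let G₀ := F.matMul Vᵀ C
  let G := if opt.zeroG ∧ C 0 0 = 0 then zeroEntry G₀ 1 1 else G₀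
  let L₀ := F.matMul B U
  let L := if opt.zeroL ∧ B 1 1 = 0 then zeroEntry L₀ 0 1 else L₀
  let Ghat := F.matMul (matAbs V)ᵀ (matAbs C)
  let H := F.matMul adjA L
  let Lhat := F.matMul (matAbs B) (matAbs U)
  let Hhat := F.matMul (matAbs adjA) Lhat
  let K := F.matMul G adjA
  let Khat := F.matMul Ghat (matAbs adjA)
  let ηg := F.eta (Ghat 0 0) (Ghat 0 1) (G 0 0) (G 0 1)
  let ηh := F.eta (Hhat 0 1) (Hhat 1 1) (H 0 1) (H 1 1)
  let ηk := F.eta (Khat 0 0) (Khat 0 1) (K 0 0) (K 0 1)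
  let ηl := F.eta (Lhat 0 1) (Lhat 1 1) (L 0 1) (L 1 1)
  let (cq, sq) :=
    if F.add |H 0 1| |H 1 1| = 0 ∨ (F.add |G 0 0| |G 0 1| ≠ 0 ∧ ηg ≤ ηh) then
      F.lartg (G 0 0) (G 0 1)
    else F.lartg (H 1 1) (-H 0 1)
  let Q := rot cq (-sq)
  let (cp, sp) :=
    if F.add |K 0 0| |K 0 1| = 0 ∨ (F.add |L 0 1| |L 1 1| ≠ 0 ∧ ηl ≤ ηk) then
      F.lartg (L 1 1) (-L 0 1)
    else F.lartg (K 0 0) (K 0 1)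
  let P := rot cp (-sp)
  { P := P
    Q := Q
    U := U
    V := V
    A' := zeroEntry (F.matMul₃ opt.leftFirst Pᵀ A Q) 0 1
    B' := zeroEntry (F.matMul Pᵀ L) 0 1
    C' := zeroEntry (F.matMul G Q) 0 1
    etaMax := max 1 (max (min ηg ηh) (min ηk ηl)) }

/-- The `2 × 2` upper-triangular RSVD algorithm `RSVD22`, carried out in floating-point
arithmetic. -/
def rsvd22 (F : FloatArith) (opt : RSVD22Options) (A B C : Mat2) : RSVD22Output :=
  if C 0 0 = 0 ∧ B 1 1 = 0 then rsvd22Special F opt A B C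
  else
    let M := F.prodM A B C
    let (csl, snl, csr, snr) := F.lasv2 (M 0 0) (M 0 1) (M 1 1)
    let V := rot csl (-snl)
    let U := rot csr (-snr)
    let cmax := max |U 0 0| |V 0 0|
    let smax := max |U 0 1| |V 0 1|
    if C 0 0 ≠ 0 ∧ C 1 1 ≠ 0 ∧ B 0 0 ≠ 0 ∧ B 1 1 ≠ 0 ∧ cmax < smax then
      rsvd22Finish F opt A B C (U * rotJ) (V * rotJ)
    else rsvd22Finish F opt A B C U V

end

/-!
The only entry of `A' = Pᵀ A Q` that is not computed but set to zero is the `(1, 2)` entry, so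
the whole question is why that entry of `Pᵀ A Q` is small.  The other entries are ordinary computed
products with nearly orthogonal factors, and their rounding errors are a moderate multiple of
`u ‖A‖` (`abs_matMul₃_sub_le`).

In exact arithmetic `Vᵀ C adj(A) B U` is diagonal.  With `g` the first row of `G = Vᵀ C` and `l` the
second column of `L = B U` this says `g adj(A) l = 0`.  The first column of `Q` is parallel to `g`,
or orthogonal to `h = adj(A) l`; the second column of `P` is parallel to `l`, or orthogonal to
`k = g adj(A)`; in exact arithmetic the alternatives agree, and the `(1, 2)` entry of `Pᵀ A Q`
vanishes in each combination of them.

In floating-point arithmetic, three facts survive.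
* The computed `M` is the exact product `C' adj(A') B'` of entrywise relative perturbations of the
  factors (`FloatArith.prodM_near`).
* The numbers computed by `xLASV2` are, each to within about `55` rounding errors, the entries of
  exact matrices `U'`, `V'` for which `V'ᵀ M U'` is diagonal (`FloatArith.lasv2_near`).  These
  matrices need not be normalized, because the rest of the argument is invariant under scaling.
* Hence the computed `g` differs from the exact first row `g'` of `V'ᵀ C'` by about `61 u` times the
  accumulated absolute values in its computation, and the quotient `η_g` converts this into an error
  of `61 u η_g` relative to `g` itself; similarly for `l`, `h`, `k`, with at most `66 u`
  (`FloatArith.error_le_of_eta_le`).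

Since `g' adj(A') l' = 0`, also `k' A' h' = det(A') g' adj(A') l' = 0`.  If `Q` comes from `g` and
`P` from `l`, the `(1, 2)` entry is `-g adj(A) l`, divided by the lengths of `g` and `l`; if they
come from `h` and `k`, it is `k A h`, divided by the lengths.  Either is a perturbation of a bilinear
expression that vanishes, and is bounded by about `4 · 66 u η ‖A‖`.  In the two mixed cases, `h` was
computed from the same `l` that determines `P`, or `k` from the same `g` that determines `Q`, and
only the rounding errors of that one product enter (`abs_annihilated_entry_le`).

Rounding errors are counted with factors `exp τ`, `|τ| ≤ k w`, `w = -log (1 - u)` (`RelNear`): then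
the counts simply add, and second-order terms appear only at the very end, where they are absorbed
by the smallness of `u η`.
-/

noncomputable section

/-! ### Relative perturbations on a logarithmic scale -/

/-- `y` is `x` up to a relative perturbation of `k` units of size `w`, measured on the logarithmic
scale: `y = x * exp τ` with `|τ| ≤ k * w`.  On this scale the perturbation counts add exactly under
products and quotients, and no second-order terms appear. -/
def RelNear (w k x y : ℝ) : Prop := ∃ τ : ℝ, |τ| ≤ k * w ∧ y = x * Real.exp τ

namespace RelNear

variable {w k l x y z x' y' : ℝ}

lemma refl (hw : 0 ≤ w) (hk : 0 ≤ k) (x : ℝ) : RelNear w k x x :=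
  ⟨0, by simpa using mul_nonneg hk hw, by simp⟩

lemma mono (h : RelNear w k x y) (hw : 0 ≤ w) (hkl : k ≤ l) : RelNear w l x y := by
  obtain ⟨τ, hτ, rfl⟩ := h
  exact ⟨τ, hτ.trans (mul_le_mul_of_nonneg_right hkl hw), rfl⟩

lemma symm (h : RelNear w k x y) : RelNear w k y x := by
  obtain ⟨τ, hτ, rfl⟩ := h
  exact ⟨-τ, by rwa [abs_neg], by rw [mul_assoc, ← Real.exp_add]; simp⟩

lemma trans (h : RelNear w k x y) (h' : RelNear w l y z) : RelNear w (k + l) x z := by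
  obtain ⟨τ, hτ, rfl⟩ := h
  obtain ⟨σ, hσ, rfl⟩ := h'
  exact ⟨τ + σ, by rw [add_mul]; exact (abs_add_le _ _).trans (add_le_add hτ hσ),
    by rw [Real.exp_add, mul_assoc]⟩

lemma mul (h : RelNear w k x y) (h' : RelNear w l x' y') :
    RelNear w (k + l) (x * x') (y * y') := by
  obtain ⟨τ, hτ, rfl⟩ := h
  obtain ⟨σ, hσ, rfl⟩ := h'
  exact ⟨τ + σ, by rw [add_mul]; exact (abs_add_le _ _).trans (add_le_add hτ hσ),
    by rw [Real.exp_add]; ring⟩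

lemma inv (h : RelNear w k x y) : RelNear w k x⁻¹ y⁻¹ := by
  obtain ⟨τ, hτ, rfl⟩ := h
  exact ⟨-τ, by rwa [abs_neg], by rw [Real.exp_neg, mul_inv]⟩

lemma div (h : RelNear w k x y) (h' : RelNear w l x' y') :
    RelNear w (k + l) (x / x') (y / y') := by
  simpa [div_eq_mul_inv] using h.mul h'.inv

lemma neg (h : RelNear w k x y) : RelNear w k (-x) (-y) := by
  obtain ⟨τ, hτ, rfl⟩ := h
  exact ⟨τ, hτ, by ring⟩

lemma sqrt (h : RelNear w k x y) : RelNear w (k / 2) (Real.sqrt x) (Real.sqrt y) := by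
  obtain ⟨τ, hτ, rfl⟩ := h
  refine ⟨τ / 2, ?_, ?_⟩
  · rw [abs_div, abs_two]; linarith
  · rw [Real.sqrt_mul' _ (Real.exp_pos _).le, ← Real.exp_half]

lemma nonneg (h : RelNear w k x y) (hx : 0 ≤ x) : 0 ≤ y := by
  obtain ⟨τ, -, rfl⟩ := h
  positivity

lemma eq_zero_iff (h : RelNear w k x y) : y = 0 ↔ x = 0 := by
  obtain ⟨τ, -, rfl⟩ := h
  simp [Real.exp_ne_zero]

lemma ne_zero (h : RelNear w k x y) (hx : x ≠ 0) : y ≠ 0 := fun hy => hx (h.eq_zero_iff.1 hy)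

lemma bounds (h : RelNear w k x y) (hx : 0 ≤ x) :
    x * Real.exp (-(k * w)) ≤ y ∧ y ≤ x * Real.exp (k * w) := by
  obtain ⟨τ, hτ, rfl⟩ := h
  obtain ⟨h1, h2⟩ := abs_le.1 hτ
  exact ⟨mul_le_mul_of_nonneg_left (Real.exp_le_exp.2 h1) hx,
    mul_le_mul_of_nonneg_left (Real.exp_le_exp.2 h2) hx⟩

lemma of_bounds (hx : 0 ≤ x) (h1 : x * Real.exp (-(k * w)) ≤ y) (h2 : y ≤ x * Real.exp (k * w))
    (hkw : 0 ≤ k * w) : RelNear w k x y := by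
  rcases hx.eq_or_lt with rfl | hx
  · exact ⟨0, by simpa using hkw, by simp at h1 h2 ⊢; linarith⟩
  · have hy : 0 < y := lt_of_lt_of_le (by positivity) h1
    refine ⟨Real.log (y / x), ?_, ?_⟩
    · rw [abs_le, Real.le_log_iff_exp_le (by positivity), Real.log_le_iff_le_exp (by positivity),
        le_div_iff₀ hx, div_le_iff₀ hx]
      exact ⟨by linarith, by linarith⟩
    · rw [Real.exp_log (by positivity)]; field_simp

/-- Adding nonnegative quantities does not amplify relative perturbations. -/
lemma add_nonneg (h : RelNear w k x y) (h' : RelNear w k x' y') (hx : 0 ≤ x) (hx' : 0 ≤ x')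
    (hkw : 0 ≤ k * w) : RelNear w k (x + x') (y + y') := by
  obtain ⟨a, b⟩ := h.bounds hx
  obtain ⟨c, d⟩ := h'.bounds hx'
  exact of_bounds (by positivity) (by linarith) (by linarith) hkw

/-- Adding quantities of equal sign does not amplify relative perturbations. -/
lemma add_of_same_sign (h : RelNear w k x y) (h' : RelNear w k x' y') (hxx : 0 ≤ x * x')
    (hkw : 0 ≤ k * w) : RelNear w k (x + x') (y + y') := by
  rcases mul_nonneg_iff.1 hxx with ⟨hx, hx'⟩ | ⟨hx, hx'⟩
  · exact h.add_nonneg h' hx hx' hkw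
  · simpa [add_comm] using (h.neg.add_nonneg h'.neg (by linarith) (by linarith) hkw).neg

/-- Subtraction from `2` of a quantity in `[0, 1]` costs at most three halves of the
perturbation. -/
lemma two_sub (h : RelNear w 2 x y) (hw : 0 ≤ w) (hw1 : w ≤ 1 / 100) (hx : 0 ≤ x) (hx1 : x ≤ 1) :
    RelNear w 3 (2 - x) (2 - y) := by
  obtain ⟨h1, h2⟩ := h.bounds hx
  have e1 : Real.exp (2 * w) ≤ 1 / (1 - 2 * w) :=
    Real.exp_bound_div_one_sub_of_interval (by linarith) (by linarith)
  have e1' : Real.exp (2 * w) ≤ 1 + 2.1 * w := e1.trans (by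
    rw [div_le_iff₀ (by linarith)]; nlinarith)
  have e2 : 1 - 2 * w ≤ Real.exp (-(2 * w)) := by linarith [Real.add_one_le_exp (-(2 * w))]
  have e3 : 1 + 3 * w ≤ Real.exp (3 * w) := by linarith [Real.add_one_le_exp (3 * w)]
  have e4 : Real.exp (-(3 * w)) ≤ 1 - 2.1 * w := by
    rw [Real.exp_neg, inv_le_comm₀ (Real.exp_pos _) (by linarith)]
    refine le_trans ?_ e3
    rw [inv_le_iff_one_le_mul₀ (by linarith)]; nlinarith
  refine of_bounds (by linarith) ?_ ?_ (by linarith)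
  · have := mul_le_mul_of_nonneg_left e1' hx
    have := mul_le_mul_of_nonneg_left e4 (by linarith : 0 ≤ 2 - x)
    nlinarith
  · have := mul_le_mul_of_nonneg_left e2 hx
    have := mul_le_mul_of_nonneg_left e3 (by linarith : 0 ≤ 2 - x)
    nlinarith

end RelNear

namespace FloatArith

variable (F : FloatArith)

/-- The unit roundoff on the logarithmic scale: every factor `1 + δ` with `|δ| ≤ u` is `exp τ` with
`|τ| ≤ -log (1 - u)`. -/
def unit : ℝ := -Real.log (1 - F.u)

variable {F}

lemma unit_nonneg (hu : F.u < 1) : 0 ≤ F.unit := by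
  have := Real.log_nonpos (x := 1 - F.u) (by linarith) (by linarith [F.u_pos])
  unfold unit; linarith

lemma u_le_unit (hu : F.u < 1) : F.u ≤ F.unit := by
  have := Real.log_le_sub_one_of_pos (x := 1 - F.u) (by linarith)
  unfold unit; linarith

lemma unit_le (hu : F.u < 1) : F.unit ≤ F.u / (1 - F.u) := by
  have := Real.one_sub_inv_le_log_of_pos (x := 1 - F.u) (by linarith)
  have h2 : F.u / (1 - F.u) = (1 - F.u)⁻¹ - 1 := by
    have : 1 - F.u ≠ 0 := by linarith
    field_simp; ring
  unfold unit; linarith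

lemma exp_unit (hu : F.u < 1) : Real.exp F.unit = (1 - F.u)⁻¹ := by
  rw [unit, Real.exp_neg, Real.exp_log (by linarith)]

lemma relNear_of_rounding (hu : F.u < 1) (x : ℝ) {δ : ℝ} (hδ : |δ| ≤ F.u) :
    RelNear F.unit 1 x (x * (1 + δ)) := by
  obtain ⟨h1, h2⟩ := abs_le.1 hδ
  have hp : 0 < 1 + δ := by linarith
  refine ⟨Real.log (1 + δ), ?_, by rw [Real.exp_log hp]⟩
  rw [_root_.one_mul, abs_le]
  constructor
  · rw [unit, neg_neg]
    exact Real.log_le_log (by linarith) (by linarith)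
  · rw [unit, ← Real.log_inv]
    refine Real.log_le_log hp ?_
    rw [le_inv_comm₀ hp (by linarith), le_inv_comm₀ (by linarith) hp, ← one_div,
      le_div_iff₀ (by linarith)]
    nlinarith

lemma near_add (hu : F.u < 1) (a b : ℝ) : RelNear F.unit 1 (a + b) (F.add a b) := by
  obtain ⟨δ, h, e⟩ := F.add_spec a b
  exact e ▸ relNear_of_rounding hu _ h

lemma near_sub (hu : F.u < 1) (a b : ℝ) : RelNear F.unit 1 (a - b) (F.sub a b) := by
  obtain ⟨δ, h, e⟩ := F.sub_spec a b
  exact e ▸ relNear_of_rounding hu _ h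

lemma near_mul (hu : F.u < 1) (a b : ℝ) : RelNear F.unit 1 (a * b) (F.mul a b) := by
  obtain ⟨δ, h, e⟩ := F.mul_spec a b
  exact e ▸ relNear_of_rounding hu _ h

lemma near_div (hu : F.u < 1) (a : ℝ) {b : ℝ} (hb : b ≠ 0) :
    RelNear F.unit 1 (a / b) (F.div a b) := by
  obtain ⟨δ, h, e⟩ := F.div_spec a b hb
  exact e ▸ relNear_of_rounding hu _ h

lemma near_sqrt (hu : F.u < 1) {a : ℝ} (ha : 0 ≤ a) :
    RelNear F.unit 1 (Real.sqrt a) (F.sqrt a) := by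
  obtain ⟨δ, h, e⟩ := F.sqrt_spec a ha
  exact e ▸ relNear_of_rounding hu _ h

section Propagation

variable {k l x y x' y' : ℝ}

lemma near_mul_of (hu : F.u < 1) (h : RelNear F.unit k x y) (h' : RelNear F.unit l x' y') :
    RelNear F.unit (k + l + 1) (x * x') (F.mul y y') :=
  (h.mul h').trans (near_mul hu _ _)

lemma near_div_of (hu : F.u < 1) (h : RelNear F.unit k x y) (h' : RelNear F.unit l x' y')
    (hx' : x' ≠ 0) : RelNear F.unit (k + l + 1) (x / x') (F.div y y') :=
  (h.div h').trans (near_div hu _ (h'.ne_zero hx'))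

lemma near_add_of (hu : F.u < 1) (h : RelNear F.unit k x y) (h' : RelNear F.unit k x' y')
    (hxx : 0 ≤ x * x') (hk : 0 ≤ k) : RelNear F.unit (k + 1) (x + x') (F.add y y') :=
  (h.add_of_same_sign h' hxx (mul_nonneg hk (unit_nonneg hu))).trans (near_add hu _ _)

lemma near_sqrt_of (hu : F.u < 1) (h : RelNear F.unit k x y) (hx : 0 ≤ x) :
    RelNear F.unit (k / 2 + 1) (Real.sqrt x) (F.sqrt y) :=
  h.sqrt.trans (near_sqrt hu (h.nonneg hx))

end Propagation

end FloatArith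

/-! ### Accuracy of the computed rotations -/

namespace FloatArith

variable {F : FloatArith}

/-- The pair computed by `lartg` is, componentwise to relative accuracy `3`, an exact unit vector
parallel to `(f, g)`. -/
lemma lartg_near (hu : F.u < 1) (f g : ℝ) (hfg : f ≠ 0 ∨ g ≠ 0) :
    ∃ c s ρ : ℝ, c ^ 2 + s ^ 2 = 1 ∧ ρ ≠ 0 ∧ f = ρ * c ∧ g = ρ * s ∧
      RelNear F.unit 3 c (F.lartg f g).1 ∧ RelNear F.unit 3 s (F.lartg f g).2 := by
  have hw := unit_nonneg hu
  by_cases hg : g = 0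
  · subst hg
    have hf : f ≠ 0 := by simpa using hfg
    refine ⟨1, 0, f, by norm_num, hf, by ring, by ring, ?_, ?_⟩ <;>
    · simp only [lartg, if_true]
      exact RelNear.refl hw (by norm_num) _
  by_cases hf : f = 0
  · subst hf
    refine ⟨0, 1, g, by norm_num, hg, by ring, by ring, ?_, ?_⟩ <;>
    · simp only [lartg, if_true, if_neg hg]
      exact RelNear.refl hw (by norm_num) _
  have hp : 0 < f * f + g * g := by
    have := mul_self_pos.2 hf; have := mul_self_pos.2 hg; linarith
  have hr : RelNear F.unit 2 (Real.sqrt (f * f + g * g))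
      (F.sqrt (F.add (F.mul f f) (F.mul g g))) :=
    (near_sqrt_of hu (near_add_of hu (near_mul hu f f) (near_mul hu g g)
      (mul_nonneg (mul_self_nonneg f) (mul_self_nonneg g)) (by norm_num)) hp.le).mono hw (by norm_num)
  have hs := Real.sqrt_pos.2 hp
  have hsq := Real.sq_sqrt hp.le
  set r := Real.sqrt (f * f + g * g)
  have hc := (near_div_of hu (RelNear.refl hw le_rfl f) hr hs.ne').mono hw
    (show (0 + 2 + 1 : ℝ) ≤ 3 by norm_num)
  have hsn := (near_div_of hu (RelNear.refl hw le_rfl g) hr hs.ne').mono hw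
    (show (0 + 2 + 1 : ℝ) ≤ 3 by norm_num)
  have h1 : (f / r) ^ 2 + (g / r) ^ 2 = 1 := by field_simp; linarith
  simp only [lartg, if_neg hg, if_neg hf]
  split_ifs
  · exact ⟨-(f / r), -(g / r), -r, by linarith, by linarith, by field_simp, by field_simp,
      hc.neg, hsn.neg⟩
  · exact ⟨f / r, g / r, r, h1, hs.ne', by field_simp, by field_simp, hc, hsn⟩

/-- If the vectors `(c₁, s₁)` and `(c₂, s₂)` satisfy these two equations, then `(c₁, s₁)` is
orthogonal to `M (-s₂, c₂)ᵀ` and `(-s₁, c₁)` is orthogonal to `M (c₂, s₂)ᵀ`, where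
`M = [f g; 0 h]`: the corresponding (scaled) rotations diagonalize `M`.  The vectors need not be
normalized. -/
def Diagonalizes (f g h c₁ s₁ c₂ s₂ : ℝ) : Prop :=
  c₁ * (-f * s₂ + g * c₂) + s₁ * h * c₂ = 0 ∧ -s₁ * (f * c₂ + g * s₂) + c₁ * h * s₂ = 0

/-- For `|h| ≤ |f|` tiny compared with `|g|` the singular vectors of `[f g; 0 h]` are parallel to
`(1, (h/g) ξ)` and `((f/g) υ, 1)`, where `ξ` and `υ` agree with `1` up to second order. -/
lemma exists_diagonalizes_of_small (φ ψ : ℝ) (h : |ψ| ≤ |φ|) :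
    ∃ ξ υ : ℝ, Diagonalizes φ 1 ψ 1 (ψ * ξ) (φ * υ) 1 ∧
      1 ≤ ξ * (1 + φ ^ 2) ∧ ξ ≤ 1 ∧ 1 ≤ υ * (1 + φ ^ 2) ∧ υ ≤ 1 := by
  have hsq : ψ ^ 2 ≤ φ ^ 2 := sq_le_sq.2 h
  have hcont : ContinuousOn (fun v : ℝ => φ ^ 2 * v ^ 2 + (1 + ψ ^ 2 - φ ^ 2) * v - 1)
      (Set.Icc 0 1) := by fun_prop
  -- `υ` is the root in `[0, 1]` of the quadratic equation that results from eliminating `ξ`.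
  obtain ⟨υ, ⟨h0, h1⟩, hυ⟩ := intermediate_value_Icc (zero_le_one' ℝ) hcont
    (show (0 : ℝ) ∈ _ from ⟨by norm_num, by ring_nf; positivity⟩)
  simp only at hυ
  have hp : 0 < 1 + φ ^ 2 * υ := by positivity
  have hξ : υ * (1 + ψ ^ 2 * (1 / (1 + φ ^ 2 * υ))) = 1 := by
    field_simp; linarith
  refine ⟨1 / (1 + φ ^ 2 * υ), υ, ⟨?_, ?_⟩, ?_, ?_, ?_, h1⟩
  · linear_combination φ * hξ
  · field_simp; ring
  · rw [one_div, inv_mul_eq_div, le_div_iff₀ hp]; nlinarith [sq_nonneg φ]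
  · rw [div_le_one hp]; nlinarith [sq_nonneg φ, mul_nonneg (sq_nonneg φ) h0]
  · have : 1 / (1 + φ ^ 2 * υ) ≤ 1 := by
      rw [div_le_one hp]; nlinarith [sq_nonneg φ, mul_nonneg (sq_nonneg φ) h0]
    have h3 : ψ ^ 2 * (1 / (1 + φ ^ 2 * υ)) ≤ φ ^ 2 := by
      calc _ ≤ ψ ^ 2 * 1 := mul_le_mul_of_nonneg_left this (sq_nonneg _)
        _ ≤ _ := by linarith
    nlinarith

/-- The formulas on which `xLASV2` is based: for `[1 m; 0 μ]` with largest singular value `a`, the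
doubled tangent of the right rotation is `t = 2 (a² - 1) / m`. -/
lemma diagonalizes_of_formulas {m μ a t c₂ s₂ p : ℝ} (ha : a ≠ 0) (hm : m ≠ 0)
    (hchar : a ^ 4 + μ ^ 2 = (1 + μ ^ 2 + m ^ 2) * a ^ 2) (ht : t * m = 2 * (a ^ 2 - 1))
    (hc : c₂ = 2 * p) (hs : s₂ = t * p) :
    Diagonalizes 1 m μ ((c₂ + s₂ * m) / a) (μ * s₂ / a) c₂ s₂ := by
  subst hc hs
  have ht' : t = 2 * (a ^ 2 - 1) / m := by field_simp; linarith
  subst ht'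
  constructor
  · field_simp
    linear_combination (-4 * p ^ 2) * hchar
  · field_simp
    ring

lemma Diagonalizes.scale {f g h c₁ s₁ c₂ s₂ : ℝ} (H : Diagonalizes f g h c₁ s₁ c₂ s₂) (r : ℝ) :
    Diagonalizes (r * f) (r * g) (r * h) c₁ s₁ c₂ s₂ :=
  ⟨by linear_combination r * H.1, by linear_combination r * H.2⟩

/-- The exact counterpart of the quantities in `lasv2Core`: `a` is the largest singular value of
`[1 m; 0 μ]`, and `t` the doubled tangent of the right rotation. -/
lemma lasv2_exact_identities {m μ L T S R a t : ℝ} (hm : m ≠ 0)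
    (hL : L = 1 - |μ|) (hT : T = 1 + |μ|) (hL0 : 0 ≤ L)
    (hS : S = Real.sqrt (T * T + m * m)) (hR : R = Real.sqrt (L * L + m * m))
    (ha : a = 1 / 2 * (S + R)) (ht : t = (m / (S + T) + m / (R + L)) * (1 + a)) :
    0 < S ∧ 0 < R ∧ 0 < T ∧ a ^ 4 + μ ^ 2 = (1 + μ ^ 2 + m ^ 2) * a ^ 2 ∧
      t * m = 2 * (a ^ 2 - 1) := by
  have hmm : 0 < m * m := mul_self_pos.2 hm
  have hTp : 0 < T := by rw [hT]; positivity
  have hSp : 0 < S := by rw [hS]; exact Real.sqrt_pos.2 (by positivity)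
  have hRp : 0 < R := by rw [hR]; exact Real.sqrt_pos.2 (by positivity)
  have hS2 : S ^ 2 = T * T + m * m := by rw [hS]; exact Real.sq_sqrt (by positivity)
  have hR2 : R ^ 2 = L * L + m * m := by rw [hR]; exact Real.sq_sqrt (by positivity)
  have hμ : |μ| ^ 2 = μ ^ 2 := sq_abs μ
  refine ⟨hSp, hRp, hTp, ?_, ?_⟩
  · -- `b = (S - R) / 2` is the smallest singular value, with `a b = |μ|` and
    -- `a² + b² = 1 + μ² + m²`.
    have hab : a * ((S - R) / 2) = |μ| := by
      rw [ha]; linear_combination (1 / 4) * hS2 - (1 / 4) * hR2 + (1 / 4) * (T + 1 + |μ|) * hT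
        - (1 / 4) * (L + 1 - |μ|) * hL
    have hsum : a ^ 2 + ((S - R) / 2) ^ 2 = 1 + μ ^ 2 + m ^ 2 := by
      rw [ha, ← hμ]; linear_combination (1 / 2) * hS2 + (1 / 2) * hR2
        + (1 / 2) * (T + 1 + |μ|) * hT + (1 / 2) * (L + 1 - |μ|) * hL
    rw [← hsum, ← hμ, ← hab]; ring
  · have h1 : m / (S + T) = (S - T) / m := by
      rw [div_eq_div_iff (by positivity) hm]; linear_combination -hS2
    have h2 : m / (R + L) = (R - L) / m := by
      rw [div_eq_div_iff (by positivity) hm]; linear_combination -hR2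
    have hLT : L + T = 2 := by rw [hL, hT]; ring
    have h3 : m / (S + T) + m / (R + L) = 2 * (a - 1) / m := by
      rw [h1, h2, ha, ← add_div]; congr 1; linear_combination -hLT
    rw [ht, h3]; field_simp; ring

lemma div_mul_div_nonneg_of_pos {m x y : ℝ} (hx : 0 < x) (hy : 0 < y) :
    0 ≤ m / x * (m / y) := by
  rw [div_mul_div_comm]; exact div_nonneg (mul_self_nonneg m) (by positivity)

/-- The accuracy of `xLASV2`: all four computed numbers have small relative errors with respect to
exact (unnormalized) rotations that diagonalize the matrix. -/
lemma lasv2Core_near (hu : F.u ≤ 1 / 1000) (f g h : ℝ) (hhf : |h| ≤ |f|) :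
    ∃ c₁ s₁ c₂ s₂ : ℝ, Diagonalizes f g h c₁ s₁ c₂ s₂ ∧
      RelNear F.unit 55 c₁ (F.lasv2Core f g h).1 ∧
      RelNear F.unit 55 s₁ (F.lasv2Core f g h).2.1 ∧
      RelNear F.unit 55 c₂ (F.lasv2Core f g h).2.2.1 ∧
      RelNear F.unit 55 s₂ (F.lasv2Core f g h).2.2.2 := by
  have hu1 : F.u < 1 := by linarith
  have hu0 := F.u_pos
  have hw := unit_nonneg hu1
  have hw1 : F.unit ≤ 1 / 100 := (unit_le hu1).trans (by
    rw [div_le_iff₀ (by linarith)]; linarith)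
  have rfl' : ∀ {k : ℝ} (_ : 0 ≤ k) (x : ℝ), RelNear F.unit k x x := fun hk x =>
    RelNear.refl hw hk x
  unfold lasv2Core
  by_cases hg : g = 0
  · simp only [hg, if_true]
    refine ⟨1, 0, 1, 0, by constructor <;> simp, ?_, ?_, ?_, ?_⟩ <;>
      exact rfl' (by norm_num) _
  rw [if_neg hg]
  by_cases hsm : |f| < |g| ∧ F.div |f| |g| < F.u
  · rw [if_pos hsm]
    obtain ⟨ξ, υ, hd, h1, h2, h3, h4⟩ := exists_diagonalizes_of_small (f / g) (h / g) (by
      rw [abs_div, abs_div]; exact div_le_div_of_nonneg_right hhf (abs_nonneg _))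
    have hsc := hd.scale g
    rw [mul_div_cancel₀ _ hg, mul_div_cancel₀ _ hg, _root_.mul_one] at hsc
    -- `|f / g|` is at most about `u`, so that its square is at most `u`.
    have hφ : |f / g| ≤ F.u / (1 - F.u) := by
      have := ((near_div hu1 |f| (abs_ne_zero.2 hg)).symm.bounds
        ((near_div hu1 |f| (abs_ne_zero.2 hg)).nonneg (by positivity))).2
      rw [_root_.one_mul, exp_unit hu1, ← abs_div] at this
      rw [div_eq_mul_inv]
      exact this.trans (mul_le_mul_of_nonneg_right hsm.2.le (inv_nonneg.2 (by linarith)))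
    have hφ2 : 1 + (f / g) ^ 2 ≤ Real.exp F.unit := by
      have e1 : F.u / (1 - F.u) ≤ 2 * F.u := by
        rw [div_le_iff₀ (by linarith)]; nlinarith
      have e2 : (f / g) ^ 2 ≤ F.u := by
        rw [← sq_abs]; nlinarith [abs_nonneg (f / g)]
      linarith [Real.add_one_le_exp F.unit, u_le_unit hu1]
    have key : ∀ z : ℝ, 1 ≤ z * (1 + (f / g) ^ 2) → z ≤ 1 → RelNear F.unit 1 z 1 := by
      intro z hz hz1
      have hp : 0 < 1 + (f / g) ^ 2 := by positivity
      have hz0 : 0 < z := by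
        by_contra hcon
        have := mul_nonneg (neg_nonneg.2 (not_lt.1 hcon)) hp.le
        linarith
      refine RelNear.of_bounds hz0.le ?_ ?_ (by linarith)
      · have : Real.exp (-(1 * F.unit)) ≤ 1 := Real.exp_le_one_iff.2 (by linarith)
        nlinarith
      · rw [_root_.one_mul]
        exact hz.trans (mul_le_mul_of_nonneg_left hφ2 hz0.le)
    refine ⟨1, h / g * ξ, f / g * υ, 1, hsc, rfl' (by norm_num) _, ?_, ?_,
      rfl' (by norm_num) _⟩
    · have := near_div hu1 h hg
      have := ((rfl' le_rfl (h / g)).mul (key ξ h1 h2)).trans (by simpa using this)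
      exact this.mono hw (by norm_num)
    · have := near_div hu1 f hg
      have := ((rfl' le_rfl (f / g)).mul (key υ h3 h4)).trans (by simpa using this)
      exact this.mono hw (by norm_num)
  rw [if_neg hsm]
  have hf : f ≠ 0 := by
    rintro rfl
    refine hsm ⟨by simpa using hg, ?_⟩
    obtain ⟨δ, -, e⟩ := F.div_spec |0| |g| (abs_ne_zero.2 hg)
    rw [e]; simpa using hu0
  have hfa : |f| ≠ 0 := abs_ne_zero.2 hf
  have hfp : 0 < |f| := abs_pos.2 hf
  -- The exact quantities of `lasv2Core` are named with capitals where the program has small letters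
  -- for `l`, `t`, `s`, `r`; primes mark the computed ones, and `t` stands for the later `t'`.
  obtain ⟨m, hm⟩ : ∃ m, m = g / f := ⟨_, rfl⟩
  obtain ⟨μ, hμ⟩ : ∃ μ, μ = h / f := ⟨_, rfl⟩
  have hm0 : m ≠ 0 := by rw [hm]; exact div_ne_zero hg hf
  have hμ1 : |μ| ≤ 1 := by rw [hμ, abs_div]; exact (div_le_one hfp).2 hhf
  obtain ⟨L, hL⟩ : ∃ L, L = 1 - |μ| := ⟨_, rfl⟩
  obtain ⟨T, hT⟩ : ∃ T, T = 1 + |μ| := ⟨_, rfl⟩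
  obtain ⟨S, hS⟩ : ∃ S, S = Real.sqrt (T * T + m * m) := ⟨_, rfl⟩
  obtain ⟨R, hR⟩ : ∃ R, R = Real.sqrt (L * L + m * m) := ⟨_, rfl⟩
  obtain ⟨a, ha⟩ : ∃ a, a = 1 / 2 * (S + R) := ⟨_, rfl⟩
  obtain ⟨t, ht⟩ : ∃ t, t = (m / (S + T) + m / (R + L)) * (1 + a) := ⟨_, rfl⟩
  have hL0 : 0 ≤ L := by linarith
  have hL1 : L ≤ 1 := by linarith [abs_nonneg μ]
  obtain ⟨hSp, hRp, hTp, hchar, htm⟩ := lasv2_exact_identities hm0 hL hT hL0 hS hR ha ht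
  have hap : 0 < a := by rw [ha]; positivity
  have htm0 : 0 ≤ t * m := by
    rw [ht]
    have : 0 ≤ (m * m / (S + T) + m * m / (R + L)) * (1 + a) := by
      have := mul_self_nonneg m; positivity
    calc (0 : ℝ) ≤ _ := this
      _ = _ := by ring
  obtain ⟨d', hd'⟩ : ∃ d', d' = F.sub |f| |h| := ⟨_, rfl⟩
  obtain ⟨L', hL'⟩ : ∃ L', L' = if d' = |f| then 1 else F.div d' |f| := ⟨_, rfl⟩
  obtain ⟨m', hm'⟩ : ∃ m', m' = F.div g f := ⟨_, rfl⟩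
  obtain ⟨T', hT'⟩ : ∃ T', T' = F.sub 2 L' := ⟨_, rfl⟩
  obtain ⟨S', hS'⟩ : ∃ S', S' = F.sqrt (F.add (F.mul T' T') (F.mul m' m')) := ⟨_, rfl⟩
  obtain ⟨R', hR'⟩ : ∃ R', R' = if L' = 0 then |m'| else
    F.sqrt (F.add (F.mul L' L') (F.mul m' m')) := ⟨_, rfl⟩
  obtain ⟨a', ha'⟩ : ∃ a', a' = F.mul (1 / 2) (F.add S' R') := ⟨_, rfl⟩
  simp only [← hd', ← hL', ← hm', ← hT', ← hS', ← hR', ← ha']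
  have nd : RelNear F.unit 1 (|f| - |h|) d' := hd' ▸ near_sub hu1 _ _
  have hLf : (|f| - |h|) / |f| = L := by
    rw [hL, hμ, abs_div]; field_simp
  have nL : RelNear F.unit 2 L L' := by
    rw [hL', ← hLf]
    split_ifs with hd
    · have := nd.div (rfl' le_rfl |f|)
      rw [hd, div_self hfa] at this
      exact this.mono hw (by norm_num)
    · exact (near_div_of hu1 nd (rfl' le_rfl |f|) hfa).mono hw (by norm_num)
  have nm : RelNear F.unit 1 m m' := by rw [hm, hm']; exact near_div hu1 g hf
  have nT : RelNear F.unit 4 T T' := by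
    have := (nL.two_sub hw hw1 hL0 hL1).trans (near_sub hu1 2 L')
    rw [hT', show T = 2 - L by rw [hT, hL]; ring]
    exact this.mono hw (by norm_num)
  have nmm : RelNear F.unit 3 (m * m) (F.mul m' m') :=
    (near_mul_of hu1 nm nm).mono hw (by norm_num)
  have hmm0 : F.mul m' m' ≠ 0 := nmm.ne_zero (mul_ne_zero hm0 hm0)
  have hmm := mul_self_nonneg m
  have nS : RelNear F.unit 6 S S' := by
    rw [hS, hS']
    refine (near_sqrt_of hu1 (k := 10) ((near_add_of hu1 (k := 9) ?_ (nmm.mono hw (by norm_num))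
      (by positivity) (by norm_num)).mono hw (by norm_num)) (by positivity)).mono hw (by norm_num)
    exact (near_mul_of hu1 nT nT).mono hw (by norm_num)
  have nR : RelNear F.unit 4 R R' := by
    rw [hR, hR']
    split_ifs with hz
    · have : L = 0 := nL.eq_zero_iff.1 hz
      have hab : |m'| = Real.sqrt (m' * m') := (Real.sqrt_mul_self_eq_abs m').symm
      rw [this, hab, mul_zero, zero_add]
      exact (nm.mul nm).sqrt.mono hw (by norm_num)
    · refine (near_sqrt_of hu1 (k := 6) ((near_add_of hu1 (k := 5) ?_ (nmm.mono hw (by norm_num))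
        (by positivity) (by norm_num)).mono hw (by norm_num)) (by positivity)).mono hw
        (by norm_num)
      exact (near_mul_of hu1 nL nL).mono hw (by norm_num)
  have na : RelNear F.unit 8 a a' := by
    rw [ha, ha']
    exact (near_mul_of hu1 (rfl' le_rfl _) (near_add_of hu1 (k := 6) nS
      (nR.mono hw (by norm_num)) (by positivity) (by norm_num))).mono hw (by norm_num)
  obtain ⟨t', ht'⟩ : ∃ t', t' = F.mul (F.add (F.div m' (F.add S' T'))
    (F.div m' (F.add R' L'))) (F.add 1 a') := ⟨_, rfl⟩
  simp only [if_neg hmm0, ← ht']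
  have nt : RelNear F.unit 20 t t' := by
    rw [ht, ht']
    have q1 : RelNear F.unit 9 (m / (S + T)) (F.div m' (F.add S' T')) :=
      (near_div_of hu1 nm (near_add_of hu1 nS (nT.mono hw (by norm_num)) (by positivity)
        (by norm_num)) (by positivity)).mono hw (by norm_num)
    have q2 : RelNear F.unit 9 (m / (R + L)) (F.div m' (F.add R' L')) :=
      (near_div_of hu1 nm (near_add_of hu1 nR (nL.mono hw (by norm_num)) (by positivity)
        (by norm_num)) (by positivity)).mono hw (by norm_num)
    refine (near_mul_of hu1 (near_add_of hu1 q1 q2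
      (div_mul_div_nonneg_of_pos (by positivity) (by positivity)) (by norm_num))
      (near_add_of hu1 (k := 8) (rfl' (by norm_num) 1) na (by positivity)
        (by norm_num))).mono hw (by norm_num)
  have htt := mul_self_nonneg t
  obtain ⟨l, hl⟩ : ∃ l, l = Real.sqrt (t * t + 4) := ⟨_, rfl⟩
  obtain ⟨l', hl'⟩ : ∃ l', l' = F.sqrt (F.add (F.mul t' t') 4) := ⟨_, rfl⟩
  have hlp : 0 < l := by rw [hl]; exact Real.sqrt_pos.2 (by positivity)
  have nl : RelNear F.unit 22 l l' := by
    rw [hl, hl']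
    exact (near_sqrt_of hu1 (near_add_of hu1 (k := 41)
      ((near_mul_of hu1 nt nt).mono hw (by norm_num)) (rfl' (by norm_num) 4)
      (by positivity) (by norm_num)) (by positivity)).mono hw (by norm_num)
  simp only [← hl']
  have nc : RelNear F.unit 23 (2 / l) (F.div 2 l') :=
    (near_div_of hu1 (rfl' le_rfl 2) nl hlp.ne').mono hw (by norm_num)
  have ns : RelNear F.unit 43 (t / l) (F.div t' l') :=
    (near_div_of hu1 nt nl hlp.ne').mono hw (by norm_num)
  have hdiag := (diagonalizes_of_formulas (c₂ := 2 / l) (s₂ := t / l) (p := 1 / l) hap.ne' hm0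
    hchar htm (by ring) (by ring)).scale f
  rw [_root_.mul_one, show f * m = g by rw [hm]; field_simp,
    show f * μ = h by rw [hμ]; field_simp] at hdiag
  refine ⟨_, _, _, _, hdiag, ?_, ?_, nc.mono hw (by norm_num), ns.mono hw (by norm_num)⟩
  · have hnn : 0 ≤ 2 / l * (t / l * m) := by
      calc (0 : ℝ) ≤ 2 / l * (t * m / l) := by positivity
        _ = _ := by ring
    exact (near_div_of hu1 (near_add_of hu1 (k := 45) (nc.mono hw (by norm_num))
      ((near_mul_of hu1 ns nm).mono hw (by norm_num)) hnn (by norm_num)) na hap.ne').mono hw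
      (by norm_num)
  · rw [hμ]
    exact (near_div_of hu1 (near_mul_of hu1 (near_div hu1 h hf) ns) na hap.ne').mono hw
      (by norm_num)

lemma lasv2_near (hu : F.u ≤ 1 / 1000) (f g h : ℝ) :
    ∃ c₁ s₁ c₂ s₂ : ℝ, Diagonalizes f g h c₁ s₁ c₂ s₂ ∧
      RelNear F.unit 55 c₁ (F.lasv2 f g h).1 ∧
      RelNear F.unit 55 s₁ (F.lasv2 f g h).2.1 ∧
      RelNear F.unit 55 c₂ (F.lasv2 f g h).2.2.1 ∧
      RelNear F.unit 55 s₂ (F.lasv2 f g h).2.2.2 := by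
  unfold lasv2
  split_ifs with hfh
  · -- Transposition and reversal of both coordinates interchange `f` and `h`.
    obtain ⟨c₁, s₁, c₂, s₂, ⟨e1, e2⟩, n1, n2, n3, n4⟩ := lasv2Core_near hu h g f hfh.le
    exact ⟨s₂, c₂, s₁, c₁, ⟨by linear_combination -e2, by linear_combination -e1⟩,
      n4, n3, n2, n1⟩
  · exact lasv2Core_near hu f g h (not_lt.1 hfh)

end FloatArith

/-! ### Entrywise perturbations of matrix products -/

/-- `x` differs from `x₀` by at most `(exp κ - 1) X`, where `X` is an upper bound of `|x₀|`: the
perturbation is small relative to `X`, not to `x₀`, which may have suffered cancellation. -/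
def Pert (κ x₀ X x : ℝ) : Prop := |x₀| ≤ X ∧ |x - x₀| ≤ (Real.exp κ - 1) * X

namespace Pert

variable {κ κ' x₀ X x y₀ Y y : ℝ}

lemma abs_le (h : Pert κ x₀ X x) : |x| ≤ Real.exp κ * X := by
  have h3 := abs_add_le (x - x₀) x₀
  rw [sub_add_cancel] at h3
  linarith [h.1, h.2]

lemma nonneg (h : Pert κ x₀ X x) : 0 ≤ X := (abs_nonneg _).trans h.1

lemma mono (h : Pert κ x₀ X x) (hκ : κ ≤ κ') : Pert κ' x₀ X x :=
  ⟨h.1, h.2.trans (mul_le_mul_of_nonneg_right (by linarith [Real.exp_le_exp.2 hκ]) h.nonneg)⟩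

lemma mul (h : Pert κ x₀ X x) (h' : Pert κ' y₀ Y y) : Pert (κ + κ') (x₀ * y₀) (X * Y) (x * y) := by
  have hX := h.nonneg
  have hY := h'.nonneg
  refine ⟨by rw [abs_mul]; exact mul_le_mul h.1 h'.1 (abs_nonneg _) hX, ?_⟩
  have e : x * y - x₀ * y₀ = (x - x₀) * y + x₀ * (y - y₀) := by ring
  have h1 : |(x - x₀) * y| ≤ (Real.exp κ - 1) * X * (Real.exp κ' * Y) := by
    rw [abs_mul]
    exact mul_le_mul h.2 h'.abs_le (abs_nonneg _) ((abs_nonneg _).trans h.2)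
  have h2 : |x₀ * (y - y₀)| ≤ X * ((Real.exp κ' - 1) * Y) := by
    rw [abs_mul]
    exact mul_le_mul h.1 h'.2 (abs_nonneg _) hX
  rw [e, Real.exp_add]
  calc _ ≤ _ := abs_add_le _ _
    _ ≤ _ := add_le_add h1 h2
    _ = _ := by ring

lemma add (h : Pert κ x₀ X x) (h' : Pert κ y₀ Y y) : Pert κ (x₀ + y₀) (X + Y) (x + y) := by
  refine ⟨(abs_add_le _ _).trans (add_le_add h.1 h'.1), ?_⟩
  rw [show x + y - (x₀ + y₀) = (x - x₀) + (y - y₀) by ring, mul_add]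
  exact (abs_add_le _ _).trans (add_le_add h.2 h'.2)

lemma of_relNear {w k : ℝ} (h : RelNear w k x₀ x) : Pert (k * w) x₀ |x₀| x := by
  obtain ⟨τ, hτ, rfl⟩ := h
  refine ⟨le_rfl, ?_⟩
  rw [show x₀ * Real.exp τ - x₀ = (Real.exp τ - 1) * x₀ by ring, abs_mul]
  refine mul_le_mul_of_nonneg_right ?_ (abs_nonneg _)
  obtain ⟨h1, h2⟩ := _root_.abs_le.1 hτ
  rw [_root_.abs_le]
  constructor
  · have h3 := Real.add_one_le_exp τ
    have h4 := Real.add_one_le_exp (k * w)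
    linarith
  · linarith [Real.exp_le_exp.2 h2]

lemma round {w : ℝ} (h : Pert κ x₀ X x) (h' : RelNear w 1 x y) : Pert (κ + w) x₀ X y := by
  obtain ⟨τ, hτ, rfl⟩ := h'
  have := h.mul (Pert.of_relNear (x₀ := 1) (x := Real.exp τ) ⟨τ, hτ, by simp⟩)
  simpa using this

lemma abs_sub_le {x' : ℝ} (h : Pert κ x₀ X x) (h' : Pert κ' x₀ X x') (hκ : 0 ≤ κ) (hκ' : 0 ≤ κ') :
    |x' - x| ≤ (Real.exp (κ + κ') - 1) * X := by
  have e : x' - x = (x' - x₀) - (x - x₀) := by ring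
  have h1 : |x' - x| ≤ |x' - x₀| + |x - x₀| := by rw [e]; exact abs_sub _ _
  have h2 : 0 ≤ (Real.exp κ - 1) * (Real.exp κ' - 1) * X :=
    mul_nonneg (mul_nonneg (by linarith [Real.add_one_le_exp κ])
      (by linarith [Real.add_one_le_exp κ'])) h.nonneg
  rw [Real.exp_add]
  linarith [h.2, h'.2]

end Pert

/-- Entrywise version of `Pert`. -/
def MatPert (κ : ℝ) (X₀ Xh X : Mat2) : Prop := ∀ i j, Pert κ (X₀ i j) (Xh i j) (X i j)

namespace MatPert

variable {κ κ' : ℝ} {X₀ Xh X Y₀ Yh Y : Mat2}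

lemma mono (h : MatPert κ X₀ Xh X) (hκ : κ ≤ κ') : MatPert κ' X₀ Xh X :=
  fun i j => (h i j).mono hκ

lemma of_relNear {w k : ℝ} (h : ∀ i j, RelNear w k (X₀ i j) (X i j)) :
    MatPert (k * w) X₀ (matAbs X₀) X := fun i j => Pert.of_relNear (h i j)

lemma self (X : Mat2) : MatPert 0 X (matAbs X) X :=
  fun i j => ⟨le_rfl, by simp⟩

lemma matAbs_self (X : Mat2) : MatPert 0 (matAbs X) (matAbs X) (matAbs X) :=
  fun i j => ⟨by simp [matAbs], by simp⟩

lemma transpose (h : MatPert κ X₀ Xh X) : MatPert κ X₀ᵀ Xhᵀ Xᵀ := fun i j => h j i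

lemma mul (h : MatPert κ X₀ Xh X) (h' : MatPert κ' Y₀ Yh Y) :
    MatPert (κ + κ') (X₀ * Y₀) (Xh * Yh) (X * Y) := fun i j => by
  simp only [Matrix.mul_apply, Fin.sum_univ_two]
  exact ((h i 0).mul (h' 0 j)).add ((h i 1).mul (h' 1 j))

lemma matMul {F : FloatArith} (hu : F.u < 1) (h : MatPert κ X₀ Xh X) (h' : MatPert κ' Y₀ Yh Y) :
    MatPert (κ + κ' + 2 * F.unit) (X₀ * Y₀) (Xh * Yh) (F.matMul X Y) := fun i j => by
  simp only [Matrix.mul_apply, Fin.sum_univ_two, FloatArith.matMul, Matrix.of_apply]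
  have := ((((h i 0).mul (h' 0 j)).round (FloatArith.near_mul hu _ _)).add
    (((h i 1).mul (h' 1 j)).round (FloatArith.near_mul hu _ _))).round (FloatArith.near_add hu _ _)
  rwa [show κ + κ' + 2 * F.unit = κ + κ' + F.unit + F.unit by ring]

lemma adjugate (h : MatPert κ X₀ (matAbs X₀) X) :
    MatPert κ X₀.adjugate (matAbs X₀.adjugate) X.adjugate := by
  have hneg : ∀ i j, Pert κ (-X₀ i j) |-X₀ i j| (-X i j) := fun i j => by
    have := h i j
    refine ⟨le_rfl, ?_⟩
    rw [abs_neg, show -X i j - -X₀ i j = -(X i j - X₀ i j) by ring, abs_neg]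
    exact this.2
  intro i j
  rw [Matrix.adjugate_fin_two, Matrix.adjugate_fin_two]
  fin_cases i <;> fin_cases j
  · exact h 1 1
  · exact hneg 0 1
  · exact hneg 1 0
  · exact h 0 0

lemma matMul₃ {F : FloatArith} (hu : F.u < 1) {κ'' : ℝ} {Z₀ Zh Z : Mat2} (b : Bool)
    (h : MatPert κ X₀ Xh X) (h' : MatPert κ' Y₀ Yh Y) (h'' : MatPert κ'' Z₀ Zh Z) :
    MatPert (κ + κ' + κ'' + 4 * F.unit) (X₀ * Y₀ * Z₀) (Xh * Yh * Zh) (F.matMul₃ b X Y Z) := by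
  cases b
  · have := h.matMul hu (h'.matMul hu h'')
    simp only [FloatArith.matMul₃, Bool.false_eq_true, if_false, Matrix.mul_assoc]
    convert this using 1; ring
  · have := (h.matMul hu h').matMul hu h''
    simp only [FloatArith.matMul₃, if_true]
    convert this using 1; ring

end MatPert

/-! ### The quotients `η` -/

namespace FloatArith

variable {F : FloatArith}

lemma eta_eq_top {n₁ n₂ d₁ d₂ : ℝ} (h : F.add |d₁| |d₂| = 0) : F.eta n₁ n₂ d₁ d₂ = ⊤ := by
  simp [eta, h]

lemma eta_ne_top_imp {n₁ n₂ d₁ d₂ η : ℝ} (h : F.eta n₁ n₂ d₁ d₂ ≤ (η : EReal)) :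
    F.add |d₁| |d₂| ≠ 0 := fun h0 => by
  rw [eta_eq_top h0, top_le_iff] at h
  exact EReal.coe_ne_top _ h

lemma ne_zero_or_of_eta_le (hu : F.u < 1) {n₁ n₂ d₁ d₂ η : ℝ}
    (h : F.eta n₁ n₂ d₁ d₂ ≤ (η : EReal)) : d₁ ≠ 0 ∨ d₂ ≠ 0 := by
  by_contra hc
  push Not at hc
  refine eta_ne_top_imp h ((near_add hu _ _).eq_zero_iff.2 ?_)
  simp [hc.1, hc.2]

/-- A bound on a computed quotient bounds the exact one, up to roundoff. -/
lemma sum_le_of_eta_le (hu : F.u ≤ 1 / 1000000) {n₁ n₂ d₁ d₂ η : ℝ} (hη : 0 ≤ η)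
    (h : F.eta n₁ n₂ d₁ d₂ ≤ (η : EReal)) : n₁ + n₂ ≤ 1.001 * η * (|d₁| + |d₂|) := by
  have hden := eta_ne_top_imp h
  have h0 := F.u_pos
  simp only [eta, if_neg hden, EReal.coe_le_coe_iff] at h
  obtain ⟨δ₁, b₁, e₁⟩ := F.add_spec n₁ n₂
  obtain ⟨δ₂, b₂, e₂⟩ := F.add_spec |d₁| |d₂|
  obtain ⟨δ₃, b₃, e₃⟩ := F.div_spec (F.add n₁ n₂) _ hden
  obtain ⟨l₁, -⟩ := abs_le.1 b₁
  obtain ⟨-, l₂⟩ := abs_le.1 b₂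
  obtain ⟨l₃, -⟩ := abs_le.1 b₃
  obtain ⟨l₂', -⟩ := abs_le.1 b₂
  set D := |d₁| + |d₂| with hD
  have hD0 : 0 ≤ D := by positivity
  have hden0 : 0 < F.add |d₁| |d₂| :=
    lt_of_le_of_ne (by rw [e₂]; exact mul_nonneg hD0 (by linarith)) (Ne.symm hden)
  rw [e₃, div_mul_eq_mul_div, div_le_iff₀ hden0, e₁, e₂] at h
  rcases le_total (n₁ + n₂) 0 with hn | hn
  · exact hn.trans (by positivity)
  · have h1 : (n₁ + n₂) * 0.999998 ≤ (n₁ + n₂) * ((1 + δ₁) * (1 + δ₃)) :=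
      mul_le_mul_of_nonneg_left (by nlinarith) hn
    have h2 : η * (D * (1 + δ₂)) ≤ η * (D * 1.000001) :=
      mul_le_mul_of_nonneg_left (mul_le_mul_of_nonneg_left (by linarith) hD0) hη
    have h3 : 0 ≤ η * D := by positivity
    nlinarith

lemma exp_unit_mul_sub_one_le (hu : F.u ≤ 1 / 1000000) {k : ℝ} (hk : 0 ≤ k) (hk' : k ≤ 66) :
    Real.exp (k * F.unit) - 1 ≤ 1.0001 * k * F.u := by
  have h0 := F.u_pos
  have hw := unit_nonneg (F := F) (by linarith)
  have h1 : F.unit ≤ 1.00001 * F.u := (unit_le (by linarith)).trans (by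
    rw [div_le_iff₀ (by linarith)]; nlinarith)
  have h2 : k * F.unit ≤ 66 * F.unit := mul_le_mul_of_nonneg_right hk' hw
  have h3 := Real.exp_bound_div_one_sub_of_interval (x := k * F.unit) (by positivity) (by linarith)
  have h4 : 1 / (1 - k * F.unit) ≤ 1 + 1.00008 * (k * F.unit) := by
    rw [div_le_iff₀ (by linarith)]
    have : 0 ≤ k * F.unit := by positivity
    nlinarith
  have h5 : k * F.unit ≤ k * (1.00001 * F.u) := mul_le_mul_of_nonneg_left h1 hk
  nlinarith [mul_nonneg hk h0.le]

/-- The role of `η`: entries computed with an error that is small relative to the accumulated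
absolute values are, if the quotient of the latter by the computed entries is at most `η`, computed
with an error relative to themselves that is at most `η` times larger. -/
lemma error_le_of_eta_le (hu : F.u ≤ 1 / 1000000) {κ κ' η : ℝ} (hκ : 0 ≤ κ) (hκ' : 0 ≤ κ')
    (hκκ : κ + κ' ≤ 66 * F.unit) {X₀ Xh X X' Xc : Mat2} (hX : MatPert κ X₀ Xh X)
    (hX' : MatPert κ' X₀ Xh X') (hc : MatPert (4 * F.unit) Xh Xh Xc) (hη : 0 ≤ η)
    {i i' j j' : Fin 2} (h : F.eta (Xc i j) (Xc i' j') (X i j) (X i' j') ≤ (η : EReal)) :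
    |X' i j - X i j| + |X' i' j' - X i' j'| ≤ 66.2 * F.u * η * (|X i j| + |X i' j'|) := by
  have h0 := F.u_pos
  have hsum := sum_le_of_eta_le hu hη h
  have e4 := exp_unit_mul_sub_one_le hu (show (0 : ℝ) ≤ 4 by norm_num) (by norm_num)
  have e66 := exp_unit_mul_sub_one_le hu (show (0 : ℝ) ≤ 66 by norm_num) le_rfl
  have a1 := (hX i j).abs_sub_le (hX' i j) hκ hκ'
  have a2 := (hX i' j').abs_sub_le (hX' i' j') hκ hκ'
  have c1 := (abs_le.1 (hc i j).2).1
  have c2 := (abs_le.1 (hc i' j').2).1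
  have n1 := (hX i j).nonneg
  have n2 := (hX i' j').nonneg
  have ee : Real.exp (κ + κ') - 1 ≤ 66.01 * F.u := by
    have := Real.exp_le_exp.2 hκκ
    linarith
  set s := Xh i j + Xh i' j' with hs
  have hs0 : 0 ≤ s := by positivity
  set D := |X i j| + |X i' j'| with hD
  have hη0 : 0 ≤ η * D := by positivity
  have b1 : (Real.exp (4 * F.unit) - 1) * s ≤ 0.00001 * s :=
    mul_le_mul_of_nonneg_right (by linarith) hs0
  have b2 : s ≤ 1.00102 * (η * D) := by nlinarith
  have b3 : (Real.exp (κ + κ') - 1) * s ≤ 66.01 * F.u * s := mul_le_mul_of_nonneg_right ee hs0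
  have b4 : 66.01 * F.u * s ≤ 66.01 * F.u * (1.00102 * (η * D)) :=
    mul_le_mul_of_nonneg_left b2 (by positivity)
  nlinarith [mul_nonneg h0.le hη0]

/-- The matrix computed by `prodM` is the exact product for entrywise relative perturbations of the
three factors. -/
lemma prodM_near (hu : F.u < 1) (A B C : Mat2) (hA : A 1 0 = 0) (hB : B 1 0 = 0) (hC : C 1 0 = 0) :
    ∃ A' B' C' : Mat2, (∀ i j, RelNear F.unit 3 (A i j) (A' i j)) ∧
      (∀ i j, RelNear F.unit 4 (B i j) (B' i j)) ∧ (∀ i j, RelNear F.unit 4 (C i j) (C' i j)) ∧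
      F.prodM A B C = C' * A'.adjugate * B' := by
  have hw := unit_nonneg hu
  have ca := near_mul hu (C 0 0) (A 1 1)
  have ab := near_mul hu (A 0 0) (B 1 1)
  have r0 : ∀ {k : ℝ} (_ : 0 ≤ k) (x : ℝ), RelNear F.unit k x x := fun hk x =>
    RelNear.refl hw hk x
  obtain ⟨τ₁, b₁, e₁⟩ := (near_mul_of hu ca (r0 le_rfl (B 0 0))).mono hw
    (show (1 + 0 + 1 : ℝ) ≤ 4 by norm_num)
  obtain ⟨τ₂, b₂, e₂⟩ := (near_mul_of hu (r0 le_rfl (C 1 1)) ab).mono hw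
    (show (0 + 1 + 1 : ℝ) ≤ 4 by norm_num)
  obtain ⟨τ₃, b₃, e₃⟩ := near_mul_of hu ca (r0 le_rfl (B 0 1))
  obtain ⟨τ₄, b₄, e₄⟩ := near_mul_of hu (r0 le_rfl (C 0 1)) ab
  obtain ⟨τ₅, b₅, e₅⟩ := near_mul_of hu (near_mul hu (C 0 0) (A 0 1)) (r0 le_rfl (B 1 1))
  obtain ⟨σ, bσ, eσ⟩ := near_add hu (F.mul (F.mul (C 0 0) (A 1 1)) (B 0 1))
    (F.mul (C 0 1) (F.mul (A 0 0) (B 1 1)))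
  obtain ⟨ν, bν, eν⟩ := near_sub hu (F.add (F.mul (F.mul (C 0 0) (A 1 1)) (B 0 1))
    (F.mul (C 0 1) (F.mul (A 0 0) (B 1 1)))) (F.mul (F.mul (C 0 0) (A 0 1)) (B 1 1))
  refine ⟨!![A 0 0, A 0 1 * Real.exp (τ₅ + ν); 0, A 1 1],
    !![B 0 0 * Real.exp τ₁, B 0 1 * Real.exp (τ₃ + σ + ν); 0, B 1 1],
    !![C 0 0, C 0 1 * Real.exp (τ₄ + σ + ν); 0, C 1 1 * Real.exp τ₂], ?_, ?_, ?_, ?_⟩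
  · intro i j
    fin_cases i <;> fin_cases j
    · exact r0 (by norm_num) _
    · exact ⟨_, (abs_add_le _ _).trans (by linarith), rfl⟩
    · simpa [hA] using r0 (by norm_num) 0
    · exact r0 (by norm_num) _
  · intro i j
    fin_cases i <;> fin_cases j
    · exact ⟨_, b₁, rfl⟩
    · exact ⟨_, (abs_add_three _ _ _).trans (by linarith), rfl⟩
    · simpa [hB] using r0 (by norm_num) 0
    · exact r0 (by norm_num) _
  · intro i j
    fin_cases i <;> fin_cases j
    · exact r0 (by norm_num) _
    · exact ⟨_, (abs_add_three _ _ _).trans (by linarith), rfl⟩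
    · simpa [hC] using r0 (by norm_num) 0
    · exact ⟨_, b₂, rfl⟩
  · rw [Matrix.adjugate_fin_two]
    dsimp only [prodM]
    rw [e₁, e₂, eν, eσ, e₃, e₄, e₅]
    simp only [Real.exp_add]
    ext i j
    fin_cases i <;> fin_cases j <;>
      simp [Matrix.mul_apply, Fin.sum_univ_two] <;> ring

end FloatArith

/-! ### Norms of `2 × 2` matrices -/

lemma abs_entry_le_norm (A : Mat2) (i j : Fin 2) : |A i j| ≤ ‖A‖ := by
  have h := Matrix.l2_opNorm_mulVec A (EuclideanSpace.single j (1 : ℝ))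
  rw [PiLp.norm_single, norm_one, mul_one] at h
  refine le_trans ?_ h
  have := PiLp.norm_apply_le (WithLp.toLp 2 (A *ᵥ (EuclideanSpace.single j (1 : ℝ)))) i
  simpa using this

lemma rot_mem_orthogonalGroup {c s : ℝ} (h : c ^ 2 + s ^ 2 = 1) :
    rot c s ∈ Matrix.orthogonalGroup (Fin 2) ℝ := by
  rw [Matrix.mem_orthogonalGroup_iff]
  ext i j
  fin_cases i <;> fin_cases j <;>
    simp [rot, Matrix.mul_apply, Fin.sum_univ_two] <;> linarith

lemma rotJ_eq_rot : rotJ = rot 0 1 := by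
  ext i j; fin_cases i <;> fin_cases j <;> simp [rotJ, rot]

lemma norm_le_sum_abs_entries (X : Mat2) :
    ‖X‖ ≤ |X 0 0| + |X 0 1| + |X 1 0| + |X 1 1| := by
  have hX : X = Matrix.diagonal ![X 0 0, X 1 1] + Matrix.diagonal ![X 0 1, -X 1 0] * rotJ := by
    ext i j
    fin_cases i <;> fin_cases j <;> simp [rotJ, Matrix.mul_apply, Fin.sum_univ_two]
  have hJ : rotJ ∈ unitary Mat2 := by
    rw [rotJ_eq_rot]; exact rot_mem_orthogonalGroup (by norm_num)
  have h1 : ‖(![X 0 0, X 1 1] : Fin 2 → ℝ)‖ ≤ |X 0 0| + |X 1 1| := by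
    rw [pi_norm_le_iff_of_nonneg (by positivity)]
    intro i; fin_cases i <;> simp
  have h2 : ‖(![X 0 1, -X 1 0] : Fin 2 → ℝ)‖ ≤ |X 0 1| + |X 1 0| := by
    rw [pi_norm_le_iff_of_nonneg (by positivity)]
    intro i; fin_cases i <;> simp
  calc ‖X‖ = ‖Matrix.diagonal ![X 0 0, X 1 1] + Matrix.diagonal ![X 0 1, -X 1 0] * rotJ‖ := by
        rw [← hX]
    _ ≤ _ := norm_add_le _ _
    _ ≤ _ := by
        rw [CStarRing.norm_mul_mem_unitary _ hJ, Matrix.l2_opNorm_diagonal,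
          Matrix.l2_opNorm_diagonal]
        linarith

/-- An entrywise distance to an orthogonally equivalent matrix is a backward error. -/
lemma exists_backward_error {A X P Q : Mat2} (hP : P ∈ Matrix.orthogonalGroup (Fin 2) ℝ)
    (hQ : Q ∈ Matrix.orthogonalGroup (Fin 2) ℝ) {ε₀ ε₁ : ℝ}
    (h00 : |X 0 0 - (P * A * Q) 0 0| ≤ ε₀) (h01 : |X 0 1 - (P * A * Q) 0 1| ≤ ε₁)
    (h10 : |X 1 0 - (P * A * Q) 1 0| ≤ ε₀) (h11 : |X 1 1 - (P * A * Q) 1 1| ≤ ε₀) :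
    ∃ P ∈ Matrix.orthogonalGroup (Fin 2) ℝ, ∃ Q ∈ Matrix.orthogonalGroup (Fin 2) ℝ, ∃ δA : Mat2,
      X = P * (A + δA) * Q ∧ ‖δA‖ ≤ 3 * ε₀ + ε₁ := by
  have hPP : P * star P = 1 := Matrix.mem_unitaryGroup_iff.1 hP
  have hQQ : star Q * Q = 1 := Matrix.mem_unitaryGroup_iff'.1 hQ
  refine ⟨P, hP, Q, hQ, star P * (X - P * A * Q) * star Q, ?_, ?_⟩
  · rw [mul_add, add_mul]
    simp only [← mul_assoc, hPP, one_mul]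
    rw [mul_assoc _ (star Q) Q, hQQ, mul_one, add_sub_cancel]
  · rw [CStarRing.norm_mul_mem_unitary _ (Unitary.star_mem hQ),
      CStarRing.norm_mem_unitary_mul _ (Unitary.star_mem hP)]
    refine (norm_le_sum_abs_entries _).trans ?_
    simp only [Matrix.sub_apply]
    linarith

/-! ### The annihilated entry -/

lemma abs_add_abs_mul_le_two {a b c d : ℝ} (h : a ^ 2 + b ^ 2 = 1) (h' : c ^ 2 + d ^ 2 = 1) :
    (|a| + |b|) * (|c| + |d|) ≤ 2 := by
  have := sq_abs a; have := sq_abs b; have := sq_abs c; have := sq_abs d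
  nlinarith [sq_nonneg (|a| - |b|), sq_nonneg (|c| - |d|), sq_nonneg (|a| + |b| - (|c| + |d|))]

/-- The bilinear form of a matrix. -/
def bilin (x₀ x₁ : ℝ) (A : Mat2) (y₀ y₁ : ℝ) : ℝ :=
  x₀ * A 0 0 * y₀ + x₀ * A 0 1 * y₁ + x₁ * A 1 0 * y₀ + x₁ * A 1 1 * y₁

lemma abs_bilin_le {x₀ x₁ y₀ y₁ α : ℝ} {A : Mat2} (hA : ∀ i j, |A i j| ≤ α) :
    |bilin x₀ x₁ A y₀ y₁| ≤ (|x₀| + |x₁|) * α * (|y₀| + |y₁|) := by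
  have key : ∀ x y i j, |x * A i j * y| ≤ |x| * α * |y| := fun x y i j => by
    rw [abs_mul, abs_mul]
    exact mul_le_mul_of_nonneg_right (mul_le_mul_of_nonneg_left (hA i j) (abs_nonneg _))
      (abs_nonneg _)
  have h1 := key x₀ y₀ 0 0
  have h2 := key x₀ y₁ 0 1
  have h3 := key x₁ y₀ 1 0
  have h4 := key x₁ y₁ 1 1
  unfold bilin
  have t1 := abs_add_le (x₀ * A 0 0 * y₀ + x₀ * A 0 1 * y₁ + x₁ * A 1 0 * y₀) (x₁ * A 1 1 * y₁)
  have t2 := abs_add_le (x₀ * A 0 0 * y₀ + x₀ * A 0 1 * y₁) (x₁ * A 1 0 * y₀)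
  have t3 := abs_add_le (x₀ * A 0 0 * y₀) (x₀ * A 0 1 * y₁)
  linarith

/-- If a bilinear expression vanishes for nearby data, then it is small. -/
lemma abs_bilin_le_of_near {x₀ x₁ y₀ y₁ x₀' x₁' y₀' y₁' α θ e : ℝ} {A A' : Mat2}
    (hα : 0 ≤ α) (hθ : 0 ≤ θ) (he : 0 ≤ e)
    (hA : ∀ i j, |A i j| ≤ α) (hA' : ∀ i j, |A' i j - A i j| ≤ e * α)
    (hx : |x₀' - x₀| + |x₁' - x₁| ≤ θ * (|x₀| + |x₁|))
    (hy : |y₀' - y₀| + |y₁' - y₁| ≤ θ * (|y₀| + |y₁|)) (h0 : bilin x₀' x₁' A' y₀' y₁' = 0) :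
    |bilin x₀ x₁ A y₀ y₁| ≤
      ((1 + θ) ^ 2 * (1 + e) - 1) * α * ((|x₀| + |x₁|) * (|y₀| + |y₁|)) := by
  have b1 := abs_bilin_le (x₀ := x₀' - x₀) (x₁ := x₁' - x₁) (y₀ := y₀) (y₁ := y₁) hA
  have b2 := abs_bilin_le (x₀ := x₀') (x₁ := x₁') (y₀ := y₀) (y₁ := y₁) (A := A' - A) hA'
  have hA'' : ∀ i j, |A' i j| ≤ (1 + e) * α := fun i j => by
    have := abs_add_le (A' i j - A i j) (A i j)
    rw [sub_add_cancel] at this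
    linarith [hA i j, hA' i j]
  have b3 := abs_bilin_le (x₀ := x₀') (x₁ := x₁') (y₀ := y₀' - y₀) (y₁ := y₁' - y₁) hA''
  have hx' : |x₀'| + |x₁'| ≤ (1 + θ) * (|x₀| + |x₁|) := by
    have t1 := abs_add_le (x₀' - x₀) x₀
    have t2 := abs_add_le (x₁' - x₁) x₁
    rw [sub_add_cancel] at t1 t2
    linarith
  have e0 : bilin x₀ x₁ A y₀ y₁ = -(bilin (x₀' - x₀) (x₁' - x₁) A y₀ y₁ +
      bilin x₀' x₁' (A' - A) y₀ y₁ + bilin x₀' x₁' A' (y₀' - y₀) (y₁' - y₁)) := by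
    rw [← sub_eq_zero, ← h0]
    simp only [bilin, Matrix.sub_apply]; ring
  rw [e0, abs_neg]
  set N := |x₀| + |x₁|
  set M := |y₀| + |y₁|
  have hN : 0 ≤ N := by positivity
  have hM : 0 ≤ M := by positivity
  have c1 : (|x₀' - x₀| + |x₁' - x₁|) * α * M ≤ θ * N * α * M := by gcongr
  have c2 : (|x₀'| + |x₁'|) * (e * α) * M ≤ (1 + θ) * N * (e * α) * M := by gcongr
  have c3 : (|x₀'| + |x₁'|) * ((1 + e) * α) * (|y₀' - y₀| + |y₁' - y₁|) ≤
      (1 + θ) * N * ((1 + e) * α) * (θ * M) := by gcongr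
  calc _ ≤ _ := abs_add_three _ _ _
    _ ≤ θ * N * α * M + (1 + θ) * N * (e * α) * M + (1 + θ) * N * ((1 + e) * α) * (θ * M) :=
        add_le_add (add_le_add (b1.trans c1) (b2.trans c2)) (b3.trans c3)
    _ = _ := by ring

/-- Cancelling the lengths of two nonzero vectors against the ones of unit vectors. -/
lemma abs_le_of_unit_vectors {ρ ρ' d B b c₁ s₁ c₂ s₂ : ℝ} (hρ : ρ ≠ 0) (hρ' : ρ' ≠ 0)
    (h₁ : c₁ ^ 2 + s₁ ^ 2 = 1) (h₂ : c₂ ^ 2 + s₂ ^ 2 = 1) (hB : 0 ≤ B) (hb : |b| = |ρ * ρ' * d|)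
    (h : |b| ≤ B * ((|ρ * c₁| + |ρ * s₁|) * (|ρ' * c₂| + |ρ' * s₂|))) : |d| ≤ 2 * B := by
  have h3 := mul_le_mul_of_nonneg_left (abs_add_abs_mul_le_two h₁ h₂) hB
  have hp : 0 < |ρ * ρ'| := abs_pos.2 (mul_ne_zero hρ hρ')
  rw [hb, abs_mul] at h
  refine le_of_mul_le_mul_left (h.trans ?_) hp
  calc _ = |ρ * ρ'| * (B * ((|c₁| + |s₁|) * (|c₂| + |s₂|))) := by
        simp only [abs_mul]; ring
    _ ≤ |ρ * ρ'| * (B * 2) := mul_le_mul_of_nonneg_left h3 hp.le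
    _ = _ := by ring

lemma abs_adjugate_entry_le {A : Mat2} {α : ℝ} (hA : ∀ i j, |A i j| ≤ α) (i j : Fin 2) :
    |A.adjugate i j| ≤ α := by
  rw [Matrix.adjugate_fin_two]
  fin_cases i <;> fin_cases j <;> simp [hA]

lemma transpose_rot_mul_mul_rot_apply (A : Mat2) (cp sp cq sq : ℝ) :
    ((rot cp (-sp))ᵀ * A * rot cq (-sq)) 0 1 = bilin cp sp A (-sq) cq := by
  simp [rot, bilin, Matrix.mul_apply, Fin.sum_univ_two]; ring

/-- The heart of the argument.  Here `g`, `k` are the computed first rows of `G`, `K`, and `l`, `h`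
the computed second columns of `L`, `H`; `Q` is determined by `g` or by `h`, and `P` by `l` or by
`k`.  If `Q` comes from `g` and `P` from `l`, then the entry is `-g adj(A) l` up to scaling, and if
they come from `h` and `k`, then it is `k A h`; both vanish for nearby data.  In the mixed cases
only the rounding errors of the last product matter. -/
lemma abs_annihilated_entry_le {A A' G L H K G' L' H' K' : Mat2} {cp sp cq sq α θ e B : ℝ}
    (hp : cp ^ 2 + sp ^ 2 = 1) (hq : cq ^ 2 + sq ^ 2 = 1)
    (hα : 0 ≤ α) (hθ : 0 ≤ θ) (he : 0 ≤ e) (hB : ((1 + θ) ^ 2 * (1 + e) - 1) ≤ B)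
    (hA : ∀ i j, |A i j| ≤ α) (hA' : ∀ i j, |A' i j - A i j| ≤ e * α)
    (hH : ∀ i, |H i 1 - (A.adjugate i 0 * L 0 1 + A.adjugate i 1 * L 1 1)| ≤
      e * α * (|L 0 1| + |L 1 1|))
    (hK : ∀ j, |K 0 j - (G 0 0 * A.adjugate 0 j + G 0 1 * A.adjugate 1 j)| ≤
      e * α * (|G 0 0| + |G 0 1|))
    (hQ : (∃ ρ : ℝ, ρ ≠ 0 ∧ G 0 0 = ρ * cq ∧ G 0 1 = ρ * sq ∧
        |G' 0 0 - G 0 0| + |G' 0 1 - G 0 1| ≤ θ * (|G 0 0| + |G 0 1|)) ∨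
      (∃ ρ : ℝ, ρ ≠ 0 ∧ H 1 1 = ρ * cq ∧ -H 0 1 = ρ * sq ∧
        |H' 0 1 - H 0 1| + |H' 1 1 - H 1 1| ≤ θ * (|H 0 1| + |H 1 1|)))
    (hP : (∃ ρ : ℝ, ρ ≠ 0 ∧ K 0 0 = ρ * cp ∧ K 0 1 = ρ * sp ∧
        |K' 0 0 - K 0 0| + |K' 0 1 - K 0 1| ≤ θ * (|K 0 0| + |K 0 1|)) ∨
      (∃ ρ : ℝ, ρ ≠ 0 ∧ L 1 1 = ρ * cp ∧ -L 0 1 = ρ * sp ∧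
        (|L' 0 1 - L 0 1| + |L' 1 1 - L 1 1| ≤ θ * (|L 0 1| + |L 1 1|))))
    (hGL : bilin (G' 0 0) (G' 0 1) A'.adjugate (L' 0 1) (L' 1 1) = 0)
    (hKH : bilin (K' 0 0) (K' 0 1) A' (H' 0 1) (H' 1 1) = 0) :
    |((rot cp (-sp))ᵀ * A * rot cq (-sq)) 0 1| ≤ 2 * (B * α) := by
  rw [transpose_rot_mul_mul_rot_apply]
  have heB : e ≤ B := by
    refine le_trans ?_ hB
    nlinarith [mul_nonneg hθ he, mul_nonneg (mul_nonneg hθ hθ) he, mul_nonneg hθ hθ]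
  have hB0 : 0 ≤ B * α := mul_nonneg (he.trans heB) hα
  rcases hQ with ⟨ρ, hρ, e1, e2, eθ⟩ | ⟨ρ, hρ, e1, e2, eθ⟩ <;>
    rcases hP with ⟨σ, hσ, f1, f2, fθ⟩ | ⟨σ, hσ, f1, f2, fθ⟩
  · -- `(-sp, cp)` annihilates the computed `k`, hence `g adj(A)` up to a rounding error.
    refine abs_le_of_unit_vectors hρ one_ne_zero hq hp hB0
      (b := -sp * (K 0 0 - (G 0 0 * A.adjugate 0 0 + G 0 1 * A.adjugate 1 0)) +
        cp * (K 0 1 - (G 0 0 * A.adjugate 0 1 + G 0 1 * A.adjugate 1 1))) ?_ ?_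
    · rw [f1, f2, e1, e2, Matrix.adjugate_fin_two]
      congr 1
      simp [bilin]; ring
    · refine (abs_add_le _ _).trans ?_
      rw [abs_mul, abs_mul, abs_neg, ← e1, ← e2, one_mul, one_mul]
      have k0 := mul_le_mul_of_nonneg_left (hK 0) (abs_nonneg sp)
      have k1 := mul_le_mul_of_nonneg_left (hK 1) (abs_nonneg cp)
      have : e * α * ((|G 0 0| + |G 0 1|) * (|cp| + |sp|)) ≤
          B * α * ((|G 0 0| + |G 0 1|) * (|cp| + |sp|)) := by gcongr
      linarith
  · refine abs_le_of_unit_vectors hρ hσ hq hp hB0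
      (b := bilin (G 0 0) (G 0 1) A.adjugate (L 0 1) (L 1 1)) ?_ ?_
    · rw [← abs_neg, show L 0 1 = -(σ * sp) by linarith, e1, e2, f1, Matrix.adjugate_fin_two]
      congr 1
      simp [bilin]; ring
    · have hadj : ∀ i j, |A'.adjugate i j - A.adjugate i j| ≤ e * α := fun i j => by
        rw [Matrix.adjugate_fin_two, Matrix.adjugate_fin_two]
        fin_cases i <;> fin_cases j
        · exact hA' 1 1
        · simpa [neg_add_eq_sub, abs_sub_comm] using hA' 0 1
        · simpa [neg_add_eq_sub, abs_sub_comm] using hA' 1 0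
        · exact hA' 0 0
      refine (abs_bilin_le_of_near hα hθ he (abs_adjugate_entry_le hA) hadj eθ fθ hGL).trans ?_
      rw [e1, e2, f1, show |L 0 1| = |σ * sp| by rw [← abs_neg, f2], add_comm |σ * sp|]
      gcongr
  · refine abs_le_of_unit_vectors hσ hρ hp hq hB0
      (b := bilin (K 0 0) (K 0 1) A (H 0 1) (H 1 1)) ?_ ?_
    · rw [show H 0 1 = -(ρ * sq) by linarith, e1, f1, f2]
      congr 1
      simp [bilin]; ring
    · refine (abs_bilin_le_of_near hα hθ he hA hA' fθ eθ hKH).trans ?_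
      rw [e1, f1, f2, show |H 0 1| = |ρ * sq| by rw [← abs_neg, e2], add_comm |ρ * sq|]
      gcongr
  · -- `(cq, sq)` annihilates the computed `h`, hence `adj(A) l` up to a rounding error.
    refine abs_le_of_unit_vectors hσ one_ne_zero hp hq hB0
      (b := cq * (H 0 1 - (A.adjugate 0 0 * L 0 1 + A.adjugate 0 1 * L 1 1)) +
        sq * (H 1 1 - (A.adjugate 1 0 * L 0 1 + A.adjugate 1 1 * L 1 1))) ?_ ?_
    · rw [show L 0 1 = -(σ * sp) by linarith, show H 0 1 = -(ρ * sq) by linarith, e1, f1,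
        Matrix.adjugate_fin_two]
      congr 1
      simp [bilin]; ring
    · refine (abs_add_le _ _).trans ?_
      rw [abs_mul, abs_mul, one_mul, one_mul, ← f1, ← f2, abs_neg]
      have k0 := mul_le_mul_of_nonneg_left (hH 0) (abs_nonneg cq)
      have k1 := mul_le_mul_of_nonneg_left (hH 1) (abs_nonneg sq)
      have : e * α * ((|L 1 1| + |L 0 1|) * (|cq| + |sq|)) ≤
          B * α * ((|L 1 1| + |L 0 1|) * (|cq| + |sq|)) := by gcongr
      linarith

/-! ### Backward error analysis of the algorithm -/

lemma relNear_rot {w k c s c' s' : ℝ} (hc : RelNear w k c c') (hs : RelNear w k s s')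
    (i j : Fin 2) : RelNear w k (rot c s i j) (rot c' s' i j) := by
  fin_cases i <;> fin_cases j
  · exact hc
  · exact hs
  · exact hs.neg
  · exact hc

lemma rot_mul_rotJ (c s : ℝ) : rot c s * rotJ = rot (-s) c := by
  ext i j
  fin_cases i <;> fin_cases j <;> simp [rot, rotJ, Matrix.mul_apply, Fin.sum_univ_two]

lemma rot_hat_entry_le {A : Mat2} {α cp sp cq sq : ℝ} (hA : ∀ i j, |A i j| ≤ α)
    (hp : cp ^ 2 + sp ^ 2 = 1) (hq : cq ^ 2 + sq ^ 2 = 1) (i j : Fin 2) :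
    ((matAbs (rot cp (-sp)))ᵀ * matAbs A * matAbs (rot cq (-sq))) i j ≤ 2 * α := by
  have hα : 0 ≤ α := (abs_nonneg _).trans (hA 0 0)
  have h2 := mul_le_mul_of_nonneg_left (abs_add_abs_mul_le_two hp hq) hα
  have hA' : ∀ i j, |matAbs A i j| ≤ α := fun i j => by simpa [matAbs] using hA i j
  have key : ∀ x₀ x₁ y₀ y₁ : ℝ, |x₀| + |x₁| = |cp| + |sp| → |y₀| + |y₁| = |cq| + |sq| →
      bilin x₀ x₁ (matAbs A) y₀ y₁ ≤ 2 * α := fun x₀ x₁ y₀ y₁ hx hy => by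
    have := (le_abs_self _).trans
      (abs_bilin_le (x₀ := x₀) (x₁ := x₁) (y₀ := y₀) (y₁ := y₁) hA')
    rw [hx, hy] at this
    linarith
  have e : ((matAbs (rot cp (-sp)))ᵀ * matAbs A * matAbs (rot cq (-sq))) i j =
      bilin |rot cp (-sp) 0 i| |rot cp (-sp) 1 i| (matAbs A)
        |rot cq (-sq) 0 j| |rot cq (-sq) 1 j| := by
    simp [bilin, matAbs, Matrix.mul_apply, Fin.sum_univ_two]; ring
  rw [e]
  refine key _ _ _ _ ?_ ?_
  · fin_cases i <;> simp [rot, add_comm]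
  · fin_cases j <;> simp [rot, add_comm]

/-- The comparison of two quotients selects one that is at most the smaller one; a quotient that
is excluded from the comparison is infinite. -/
lemma eta_le_of_select {x y e : EReal} {p q : Prop} (hp : p → y = ⊤) (hq : ¬ q → x = ⊤)
    (h : min x y ≤ e) : ((p ∨ (q ∧ x ≤ y)) → x ≤ e) ∧ (¬ (p ∨ (q ∧ x ≤ y)) → y ≤ e) := by
  refine ⟨?_, fun hn => ?_⟩
  · rintro (h1 | ⟨-, h1⟩)
    · rwa [hp h1, min_top_right] at h
    · rwa [min_eq_left h1] at h
  · push Not at hn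
    by_cases hq' : q
    · rwa [min_eq_right (hn.2 hq').le] at h
    · rwa [hq hq', min_top_left] at h

/-- The intermediate quantities of `rsvd22Finish`.  Of the options that set an entry to zero,
`zeroG` does not touch the first row of `G`, which is the only one that matters here; `zeroL` acts
only if `b₂₂ = 0`. -/
lemma rsvd22Finish_outline (F : FloatArith) (opt : RSVD22Options) (A B C U V : Mat2) :
    ∃ G L : Mat2, (∀ j, G 0 j = F.matMul Vᵀ C 0 j) ∧
      ((∀ i, L i 1 = F.matMul B U i 1) ∨ L 0 1 = 0 ∧ (L 1 1 = F.matMul B U 1 1 ∧ B 1 1 = 0)) ∧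
      ∃ H K Ghat Lhat Hhat Khat : Mat2, ∃ ηg ηh ηk ηl : EReal, ∃ p q : ℝ × ℝ,
      H = F.matMul A.adjugate L ∧ K = F.matMul G A.adjugate ∧
      Ghat = F.matMul (matAbs V)ᵀ (matAbs C) ∧ Lhat = F.matMul (matAbs B) (matAbs U) ∧
      Hhat = F.matMul (matAbs A.adjugate) Lhat ∧ Khat = F.matMul Ghat (matAbs A.adjugate) ∧
      ηg = F.eta (Ghat 0 0) (Ghat 0 1) (G 0 0) (G 0 1) ∧
      ηh = F.eta (Hhat 0 1) (Hhat 1 1) (H 0 1) (H 1 1) ∧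
      ηk = F.eta (Khat 0 0) (Khat 0 1) (K 0 0) (K 0 1) ∧
      ηl = F.eta (Lhat 0 1) (Lhat 1 1) (L 0 1) (L 1 1) ∧
      q = (if F.add |H 0 1| |H 1 1| = 0 ∨ (F.add |G 0 0| |G 0 1| ≠ 0 ∧ ηg ≤ ηh) then
        F.lartg (G 0 0) (G 0 1) else F.lartg (H 1 1) (-H 0 1)) ∧
      p = (if F.add |K 0 0| |K 0 1| = 0 ∨ (F.add |L 0 1| |L 1 1| ≠ 0 ∧ ηl ≤ ηk) then
        F.lartg (L 1 1) (-L 0 1) else F.lartg (K 0 0) (K 0 1)) ∧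
      (rsvd22Finish F opt A B C U V).A' =
        zeroEntry (F.matMul₃ opt.leftFirst (rot p.1 (-p.2))ᵀ A (rot q.1 (-q.2))) 0 1 ∧
      (rsvd22Finish F opt A B C U V).etaMax = max 1 (max (min ηg ηh) (min ηk ηl)) := by
  refine ⟨if opt.zeroG ∧ C 0 0 = 0 then zeroEntry (F.matMul Vᵀ C) 1 1 else F.matMul Vᵀ C,
    if opt.zeroL ∧ B 1 1 = 0 then zeroEntry (F.matMul B U) 0 1 else F.matMul B U, ?_, ?_,
    _, _, _, _, _, _, _, _, _, _, _, _,
    rfl, rfl, rfl, rfl, rfl, rfl, rfl, rfl, rfl, rfl, rfl, rfl, rfl, rfl⟩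
  · intro j
    split_ifs
    · fin_cases j <;> simp [zeroEntry]
    · rfl
  · split_ifs with h
    · exact Or.inr ⟨by simp [zeroEntry], by simp [zeroEntry], h.2⟩
    · exact Or.inl fun i => rfl

/-- Both bilinear expressions vanish, the second one since
`adj(A) A adj(A) = det(A) adj(A)`. -/
lemma bilin_eq_zero_of_mul_adjugate {A G L : Mat2} (h : (G * A.adjugate * L) 0 1 = 0) :
    bilin (G 0 0) (G 0 1) A.adjugate (L 0 1) (L 1 1) = 0 ∧
      bilin ((G * A.adjugate) 0 0) ((G * A.adjugate) 0 1) A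
        ((A.adjugate * L) 0 1) ((A.adjugate * L) 1 1) = 0 := by
  have key : ∀ X Y Z : Mat2, bilin (X 0 0) (X 0 1) Y (Z 0 1) (Z 1 1) = (X * Y * Z) 0 1 :=
    fun X Y Z => by simp [bilin, Matrix.mul_apply, Fin.sum_univ_two]; ring
  refine ⟨by rw [key, h], ?_⟩
  rw [key, show G * A.adjugate * A * (A.adjugate * L) = G * (A.adjugate * A) * (A.adjugate * L) by
    simp only [Matrix.mul_assoc], Matrix.adjugate_mul]
  rw [Matrix.mul_smul, Matrix.mul_one, Matrix.smul_mul, ← Matrix.mul_assoc, Matrix.smul_apply, h,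
    smul_zero]

/-- The analysis of the algorithm after the computation of `U` and `V`, under the assumption that
these are componentwise close to matrices which annihilate the `(1, 2)` entry of a product
`C' adj(A') B'` with factors close to `C`, `A`, `B`. -/
lemma rsvd22Finish_spec {F : FloatArith} (opt : RSVD22Options) {A B C U V A' B' C' U' V' : Mat2}
    (hB10 : B 1 0 = 0)
    (hA : ∀ i j, RelNear F.unit 3 (A i j) (A' i j)) (hB : ∀ i j, RelNear F.unit 4 (B i j) (B' i j))
    (hC : ∀ i j, RelNear F.unit 4 (C i j) (C' i j))
    (hU : ∀ i j, RelNear F.unit 55 (U i j) (U' i j))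
    (hV : ∀ i j, RelNear F.unit 55 (V i j) (V' i j))
    (hdiag : (V'ᵀ * (C' * A'.adjugate * B') * U') 0 1 = 0) {η : ℝ}
    (hη : (rsvd22Finish F opt A B C U V).etaMax = (η : EReal)) (hsmall : F.u * η ≤ 1 / 1000000) :
    ∃ cp sp cq sq : ℝ, ∃ p q : ℝ × ℝ, cp ^ 2 + sp ^ 2 = 1 ∧ cq ^ 2 + sq ^ 2 = 1 ∧
      RelNear F.unit 3 cp p.1 ∧ RelNear F.unit 3 sp p.2 ∧
      RelNear F.unit 3 cq q.1 ∧ RelNear F.unit 3 sq q.2 ∧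
      (rsvd22Finish F opt A B C U V).A' =
        zeroEntry (F.matMul₃ opt.leftFirst (rot p.1 (-p.2))ᵀ A (rot q.1 (-q.2))) 0 1 ∧
      |((rot cp (-sp))ᵀ * A * rot cq (-sq)) 0 1| ≤ 272 * F.u * η * ‖A‖ := by
  obtain ⟨G, L, hG, hL, H, K, Ghat, Lhat, Hhat, Khat, ηg, ηh, ηk, ηl, p, q, hH, hK, hGh, hLh, hHh,
    hKh, hηg, hηh, hηk, hηl, hq, hp, hA'eq, hηeq⟩ := rsvd22Finish_outline F opt A B C U V
  rw [hηeq] at hη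
  have h0 := F.u_pos
  have hη1 : 1 ≤ η := by
    have : (1 : EReal) ≤ (η : EReal) := hη ▸ le_max_left _ _
    exact_mod_cast this
  have hη0 : 0 ≤ η := by linarith
  have hu : F.u ≤ 1 / 1000000 := le_trans (by nlinarith) hsmall
  have hu1 : F.u < 1 := by linarith
  have hw := FloatArith.unit_nonneg hu1
  have hgh : min ηg ηh ≤ (η : EReal) :=
    ((le_max_left _ _).trans (le_max_right _ _)).trans_eq hη
  have hkl : min ηk ηl ≤ (η : EReal) :=
    ((le_max_right _ _).trans (le_max_right _ _)).trans_eq hη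
  -- Each computed product and its exact counterpart (with primes) are compared with a common
  -- reference value; the exact counterparts are formed from the perturbed factors.
  have mG : MatPert (2 * F.unit) (Vᵀ * C) ((matAbs V)ᵀ * matAbs C) (F.matMul Vᵀ C) :=
    ((MatPert.self V).transpose.matMul hu1 (MatPert.self C)).mono (by linarith)
  have mGh : MatPert (2 * F.unit) ((matAbs V)ᵀ * matAbs C) ((matAbs V)ᵀ * matAbs C) Ghat := by
    rw [hGh]
    exact ((MatPert.matAbs_self V).transpose.matMul hu1 (MatPert.matAbs_self C)).mono (by linarith)
  have mG' : MatPert (59 * F.unit) (Vᵀ * C) ((matAbs V)ᵀ * matAbs C) (V'ᵀ * C') :=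
    ((MatPert.of_relNear hV).transpose.mul (MatPert.of_relNear hC)).mono (by linarith)
  have mL : MatPert (2 * F.unit) (B * U) (matAbs B * matAbs U) (F.matMul B U) :=
    ((MatPert.self B).matMul hu1 (MatPert.self U)).mono (by linarith)
  have mLh : MatPert (2 * F.unit) (matAbs B * matAbs U) (matAbs B * matAbs U) Lhat := by
    rw [hLh]
    exact ((MatPert.matAbs_self B).matMul hu1 (MatPert.matAbs_self U)).mono (by linarith)
  have mL' : MatPert (59 * F.unit) (B * U) (matAbs B * matAbs U) (B' * U') :=
    ((MatPert.of_relNear hB).mul (MatPert.of_relNear hU)).mono (by linarith)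
  have mA' := (MatPert.of_relNear hA).adjugate
  have mK := (mG.matMul hu1 (MatPert.self A.adjugate)).mono
    (show _ ≤ 4 * F.unit by linarith)
  have mKh := (mGh.matMul hu1 (MatPert.matAbs_self A.adjugate)).mono
    (show _ ≤ 4 * F.unit by linarith)
  have mK' := (mG'.mul mA').mono (show _ ≤ 62 * F.unit by linarith)
  have mH := ((MatPert.self A.adjugate).matMul hu1 mL).mono
    (show _ ≤ 4 * F.unit by linarith)
  have mHh := ((MatPert.matAbs_self A.adjugate).matMul hu1 mLh).mono
    (show _ ≤ 4 * F.unit by linarith)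
  have mH' := (mA'.mul mL').mono (show _ ≤ 62 * F.unit by linarith)
  rw [← hKh] at mKh
  rw [← hHh] at mHh
  have hKrow : ∀ j, K 0 j = F.matMul (F.matMul Vᵀ C) A.adjugate 0 j := fun j => by
    rw [hK]
    simp only [FloatArith.matMul, Matrix.of_apply]
    rw [hG 0, hG 1]
    simp only [FloatArith.matMul, Matrix.of_apply]
  have hHcol : ∀ i, H i 1 = F.add (F.mul (A.adjugate i 0) (L 0 1))
      (F.mul (A.adjugate i 1) (L 1 1)) := fun i => by rw [hH]; rfl
  -- If `l₁₂` was set to zero, then the second column of `L` vanishes.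
  have hfl0 : ∀ x y, F.mul x 0 = 0 ∧ F.mul 0 y = 0 ∧ F.add 0 0 = 0 := fun x y => by
    refine ⟨(FloatArith.near_mul hu1 _ _).eq_zero_iff.2 (by simp),
      (FloatArith.near_mul hu1 _ _).eq_zero_iff.2 (by simp),
      (FloatArith.near_add hu1 _ _).eq_zero_iff.2 (by simp)⟩
  have hLcol : (L 0 1 ≠ 0 ∨ L 1 1 ≠ 0) → ∀ i, L i 1 = F.matMul B U i 1 := by
    intro hne
    rcases hL with h | ⟨h01, h11, hb⟩
    · exact h
    · exfalso
      have : L 1 1 = 0 := by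
        rw [h11]
        simp [FloatArith.matMul, hB10, hb, (hfl0 0 _).2.1, (hfl0 0 0).2.2]
      rcases hne with h | h <;> contradiction
  have selq := eta_le_of_select (x := ηg) (y := ηh) (e := (η : EReal))
    (p := F.add |H 0 1| |H 1 1| = 0) (q := F.add |G 0 0| |G 0 1| ≠ 0)
    (fun h => by rw [hηh]; exact FloatArith.eta_eq_top h)
    (fun h => by rw [hηg]; exact FloatArith.eta_eq_top (not_not.1 h)) hgh
  have selp := eta_le_of_select (x := ηl) (y := ηk) (e := (η : EReal))
    (p := F.add |K 0 0| |K 0 1| = 0) (q := F.add |L 0 1| |L 1 1| ≠ 0)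
    (fun h => by rw [hηk]; exact FloatArith.eta_eq_top h)
    (fun h => by rw [hηl]; exact FloatArith.eta_eq_top (not_not.1 h)) (by rwa [min_comm])
  have hQ : ∃ cq sq : ℝ, cq ^ 2 + sq ^ 2 = 1 ∧ RelNear F.unit 3 cq q.1 ∧ RelNear F.unit 3 sq q.2 ∧
      ((∃ ρ : ℝ, ρ ≠ 0 ∧ G 0 0 = ρ * cq ∧ G 0 1 = ρ * sq ∧
        |(V'ᵀ * C') 0 0 - G 0 0| + |(V'ᵀ * C') 0 1 - G 0 1| ≤
          66.2 * F.u * η * (|G 0 0| + |G 0 1|)) ∨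
      (∃ ρ : ℝ, ρ ≠ 0 ∧ H 1 1 = ρ * cq ∧ -H 0 1 = ρ * sq ∧
        |(A'.adjugate * (B' * U')) 0 1 - H 0 1| + |(A'.adjugate * (B' * U')) 1 1 - H 1 1| ≤
          66.2 * F.u * η * (|H 0 1| + |H 1 1|))) := by
    split_ifs at hq with hc
    · have hle := selq.1 hc
      rw [hηg] at hle
      obtain ⟨c, s, ρ, h1, hρ, e1, e2, n1, n2⟩ := FloatArith.lartg_near hu1 (G 0 0) (G 0 1)
        (FloatArith.ne_zero_or_of_eta_le hu1 hle)
      rw [← hq] at n1 n2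
      refine ⟨c, s, h1, n1, n2, Or.inl ⟨ρ, hρ, e1, e2, ?_⟩⟩
      rw [hG 0, hG 1] at hle ⊢
      exact FloatArith.error_le_of_eta_le hu (by positivity) (by positivity) (by linarith) mG mG'
        (mGh.mono (by linarith)) hη0 hle
    · have hle := selq.2 hc
      rw [hηh] at hle
      have hne := FloatArith.ne_zero_or_of_eta_le hu1 hle
      obtain ⟨c, s, ρ, h1, hρ, e1, e2, n1, n2⟩ := FloatArith.lartg_near hu1 (H 1 1) (-H 0 1)
        (by rw [neg_ne_zero]; exact hne.symm)
      rw [← hq] at n1 n2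
      refine ⟨c, s, h1, n1, n2, Or.inr ⟨ρ, hρ, e1, e2, ?_⟩⟩
      have hLne : L 0 1 ≠ 0 ∨ L 1 1 ≠ 0 := by
        by_contra hcon
        push Not at hcon
        have : ∀ i, H i 1 = 0 := fun i => by
          rw [hHcol, hcon.1, hcon.2, (hfl0 _ 0).1, (hfl0 _ 0).1, (hfl0 0 0).2.2]
        rcases hne with h | h <;> exact h (this _)
      have hH₀ : ∀ i, H i 1 = F.matMul A.adjugate (F.matMul B U) i 1 := fun i => by
        rw [hHcol, hLcol hLne 0, hLcol hLne 1]; rfl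
      rw [hH₀ 0, hH₀ 1] at hle ⊢
      exact FloatArith.error_le_of_eta_le hu (by positivity) (by positivity) (by linarith) mH mH'
        mHh hη0 hle
  have hP : ∃ cp sp : ℝ, cp ^ 2 + sp ^ 2 = 1 ∧ RelNear F.unit 3 cp p.1 ∧ RelNear F.unit 3 sp p.2 ∧
      ((∃ ρ : ℝ, ρ ≠ 0 ∧ K 0 0 = ρ * cp ∧ K 0 1 = ρ * sp ∧
        |(V'ᵀ * C' * A'.adjugate) 0 0 - K 0 0| + |(V'ᵀ * C' * A'.adjugate) 0 1 - K 0 1| ≤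
          66.2 * F.u * η * (|K 0 0| + |K 0 1|)) ∨
      (∃ ρ : ℝ, ρ ≠ 0 ∧ L 1 1 = ρ * cp ∧ -L 0 1 = ρ * sp ∧
        |(B' * U') 0 1 - L 0 1| + |(B' * U') 1 1 - L 1 1| ≤
          66.2 * F.u * η * (|L 0 1| + |L 1 1|))) := by
    split_ifs at hp with hc
    · have hle := selp.1 hc
      rw [hηl] at hle
      have hne := FloatArith.ne_zero_or_of_eta_le hu1 hle
      obtain ⟨c, s, ρ, h1, hρ, e1, e2, n1, n2⟩ := FloatArith.lartg_near hu1 (L 1 1) (-L 0 1)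
        (by rw [neg_ne_zero]; exact hne.symm)
      rw [← hp] at n1 n2
      refine ⟨c, s, h1, n1, n2, Or.inr ⟨ρ, hρ, e1, e2, ?_⟩⟩
      rw [hLcol hne 0, hLcol hne 1] at hle ⊢
      exact FloatArith.error_le_of_eta_le hu (by positivity) (by positivity) (by linarith) mL mL'
        (mLh.mono (by linarith)) hη0 hle
    · have hle := selp.2 hc
      rw [hηk] at hle
      obtain ⟨c, s, ρ, h1, hρ, e1, e2, n1, n2⟩ := FloatArith.lartg_near hu1 (K 0 0) (K 0 1)
        (FloatArith.ne_zero_or_of_eta_le hu1 hle)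
      rw [← hp] at n1 n2
      refine ⟨c, s, h1, n1, n2, Or.inl ⟨ρ, hρ, e1, e2, ?_⟩⟩
      rw [hKrow 0, hKrow 1] at hle ⊢
      exact FloatArith.error_le_of_eta_le hu (by positivity) (by positivity) (by linarith) mK mK'
        mKh hη0 hle
  obtain ⟨cq, sq, hq1, nq1, nq2, hQ⟩ := hQ
  obtain ⟨cp, sp, hp1, np1, np2, hP⟩ := hP
  refine ⟨cp, sp, cq, sq, p, q, hp1, hq1, np1, np2, nq1, nq2, hA'eq, ?_⟩
  have hα := abs_entry_le_norm A
  have hα0 := norm_nonneg A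
  have e3 := FloatArith.exp_unit_mul_sub_one_le hu (show (0 : ℝ) ≤ 3 by norm_num) (by norm_num)
  have e3' : 0 ≤ Real.exp (3 * F.unit) - 1 := by
    linarith [Real.add_one_le_exp (3 * F.unit)]
  have e23 : Real.exp (2 * F.unit) - 1 ≤ Real.exp (3 * F.unit) - 1 := by
    linarith [Real.exp_le_exp.2 (show 2 * F.unit ≤ 3 * F.unit by linarith)]
  have e2' : 0 ≤ Real.exp (2 * F.unit) - 1 := by
    linarith [Real.add_one_le_exp (2 * F.unit)]
  obtain ⟨hGL, hKH⟩ := bilin_eq_zero_of_mul_adjugate (A := A') (G := V'ᵀ * C') (L := B' * U')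
    (by simpa only [Matrix.mul_assoc] using hdiag)
  have hz : 0 ≤ F.u * η := by positivity
  have hB' : (1 + 66.2 * F.u * η) ^ 2 * (1 + (Real.exp (3 * F.unit) - 1)) - 1 ≤
      136 * F.u * η := by
    have h1 : 1 + (Real.exp (3 * F.unit) - 1) ≤ 1 + 3.001 * (F.u * η) := by nlinarith
    have h2 : (1 + 66.2 * F.u * η) ^ 2 ≤ 1 + 132.5 * (F.u * η) := by nlinarith
    have h3 := mul_le_mul h2 h1 (by linarith) (by positivity)
    nlinarith
  have hfin := abs_annihilated_entry_le (A := A) (A' := A') (G := G) (L := L) (H := H) (K := K)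
    (G' := V'ᵀ * C') (L' := B' * U') (H' := A'.adjugate * (B' * U')) (K' := V'ᵀ * C' * A'.adjugate)
    hp1 hq1 hα0 (θ := 66.2 * F.u * η) (by positivity) e3' hB' hα
    (fun i j => ((MatPert.of_relNear hA i j).2).trans
      (mul_le_mul_of_nonneg_left (hα i j) e3')) ?_ ?_ hQ hP hGL hKH
  · linarith
  · intro i
    have := (((MatPert.self A.adjugate).matMul hu1 (MatPert.self L)) i 1).2
    rw [← hH, Matrix.mul_apply, Matrix.mul_apply, Fin.sum_univ_two, Fin.sum_univ_two, zero_add,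
      zero_add] at this
    refine this.trans ?_
    rw [mul_assoc]
    refine mul_le_mul e23 ?_ (by simp only [matAbs, Matrix.of_apply]; positivity) e3'
    have a0 := mul_le_mul_of_nonneg_right (abs_adjugate_entry_le hα i 0) (abs_nonneg (L 0 1))
    have a1 := mul_le_mul_of_nonneg_right (abs_adjugate_entry_le hα i 1) (abs_nonneg (L 1 1))
    simp only [matAbs, Matrix.of_apply]
    linarith
  · intro j
    have := (((MatPert.self G).matMul hu1 (MatPert.self A.adjugate)) 0 j).2
    rw [← hK, Matrix.mul_apply, Matrix.mul_apply, Fin.sum_univ_two, Fin.sum_univ_two, zero_add,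
      zero_add] at this
    refine this.trans ?_
    rw [mul_assoc]
    refine mul_le_mul e23 ?_ (by simp only [matAbs, Matrix.of_apply]; positivity) e3'
    have a0 := mul_le_mul_of_nonneg_left (abs_adjugate_entry_le hα 0 j) (abs_nonneg (G 0 0))
    have a1 := mul_le_mul_of_nonneg_left (abs_adjugate_entry_le hα 1 j) (abs_nonneg (G 0 1))
    simp only [matAbs, Matrix.of_apply]
    linarith

/-- Outside the special branch the algorithm ends with `rsvd22Finish`, applied to matrices that are
componentwise close to ones which diagonalize the computed product. -/
lemma rsvd22_eq_finish {F : FloatArith} (hu : F.u ≤ 1 / 1000) (opt : RSVD22Options) (A B C : Mat2)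
    (hs : ¬ (C 0 0 = 0 ∧ B 1 1 = 0)) :
    ∃ U V U' V' : Mat2, rsvd22 F opt A B C = rsvd22Finish F opt A B C U V ∧
      (∀ i j, RelNear F.unit 55 (U i j) (U' i j)) ∧ (∀ i j, RelNear F.unit 55 (V i j) (V' i j)) ∧
      (V'ᵀ * F.prodM A B C * U') 0 1 = 0 := by
  have hM : F.prodM A B C 1 0 = 0 := rfl
  obtain ⟨c₁, s₁, c₂, s₂, ⟨d1, d2⟩, n1, n2, n3, n4⟩ := FloatArith.lasv2_near hu
    (F.prodM A B C 0 0) (F.prodM A B C 0 1) (F.prodM A B C 1 1)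
  unfold rsvd22
  rw [if_neg hs]
  dsimp only
  split_ifs
  · -- Multiplication by `J` moves the other annihilated off-diagonal entry to position `(1, 2)`.
    refine ⟨_, _, rot s₂ (-(-c₂)), rot s₁ (-(-c₁)), rfl, ?_, ?_, ?_⟩
    · rw [rot_mul_rotJ]
      exact relNear_rot (by simpa using n4.symm) (by simpa using n3.symm)
    · rw [rot_mul_rotJ]
      exact relNear_rot (by simpa using n2.symm) (by simpa using n1.symm)
    · rw [transpose_rot_mul_mul_rot_apply, bilin, hM]
      linear_combination -d2
  · refine ⟨_, _, rot c₂ (-s₂), rot c₁ (-s₁), rfl, relNear_rot n3.symm n4.symm.neg,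
      relNear_rot n1.symm n2.symm.neg, ?_⟩
    rw [transpose_rot_mul_mul_rot_apply, bilin, hM]
    linear_combination d1

/-- Computed products with componentwise accurate rotations are accurate relative to the norm. -/
lemma abs_matMul₃_sub_le {F : FloatArith} (hu : F.u ≤ 1 / 1000000) (b : Bool) (A : Mat2)
    {cp sp cq sq cp' sp' cq' sq' : ℝ} (hp : cp ^ 2 + sp ^ 2 = 1) (hq : cq ^ 2 + sq ^ 2 = 1)
    (np : RelNear F.unit 3 cp cp') (np' : RelNear F.unit 3 sp sp')
    (nq : RelNear F.unit 3 cq cq') (nq' : RelNear F.unit 3 sq sq') (i j : Fin 2) :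
    |F.matMul₃ b (rot cp' (-sp'))ᵀ A (rot cq' (-sq')) i j -
      ((rot cp (-sp))ᵀ * A * rot cq (-sq)) i j| ≤ 20.1 * F.u * ‖A‖ := by
  have h0 := F.u_pos
  have e10 := FloatArith.exp_unit_mul_sub_one_le hu (show (0 : ℝ) ≤ 10 by norm_num) (by norm_num)
  have h := (MatPert.matMul₃ (by linarith) b (MatPert.of_relNear (relNear_rot np np'.neg)).transpose
    (MatPert.self A) (MatPert.of_relNear (relNear_rot nq nq'.neg)) i j)
  rw [show 3 * F.unit + 0 + 3 * F.unit + 4 * F.unit = 10 * F.unit by ring] at h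
  have h1 := rot_hat_entry_le (abs_entry_le_norm A) hp hq i j
  calc _ ≤ _ := h.2
    _ ≤ 1.0001 * 10 * F.u * (2 * ‖A‖) := mul_le_mul e10 h1 h.nonneg (by positivity)
    _ ≤ _ := by nlinarith [mul_nonneg h0.le (norm_nonneg A)]

end

theorem mainTheorem3 :
    ∃ c : ℝ, 0 < c ∧
      ∀ (F : FloatArith) (opt : RSVD22Options) (A B C : Matrix (Fin 2) (Fin 2) ℝ),
        A 1 0 = 0 → B 1 0 = 0 → C 1 0 = 0 → A.det ≠ 0 →
        ∀ η : ℝ, (rsvd22 F opt A B C).etaMax = (η : EReal) →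
          171 * F.u * η ≤ c →
          ∃ P ∈ Matrix.orthogonalGroup (Fin 2) ℝ, ∃ Q ∈ Matrix.orthogonalGroup (Fin 2) ℝ,
            ∃ δA : Matrix (Fin 2) (Fin 2) ℝ,
              (rsvd22 F opt A B C).A' = P * (A + δA) * Q ∧
              ‖δA‖ ≤ (44.5 + 342 * η) * F.u * ‖A‖ := by
  -- The constant only has to make `u η`, and with it all second-order terms, negligible.
  refine ⟨171 / 1000000, by norm_num, ?_⟩
  intro F opt A B C hA10 hB10 hC10 _ η hη hc
  have h0 := F.u_pos
  have hsmall : F.u * η ≤ 1 / 1000000 := by linarith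
  have hη1 : 1 ≤ η := by
    have : (1 : EReal) ≤ (η : EReal) := by
      rw [← hη]
      unfold rsvd22
      split_ifs with hs
      · exact le_rfl
      · dsimp only
        split_ifs <;> exact le_max_left _ _
    exact_mod_cast this
  have hu : F.u ≤ 1 / 1000000 := le_trans (by nlinarith) hsmall
  have hu1 : F.u < 1 := by linarith
  have hw := FloatArith.unit_nonneg hu1
  have hA0 : 0 ≤ F.u * ‖A‖ := mul_nonneg h0.le (norm_nonneg A)
  have hAη : F.u * ‖A‖ ≤ F.u * ‖A‖ * η := le_mul_of_one_le_right hA0 hη1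
  by_cases hs : C 0 0 = 0 ∧ B 1 1 = 0
  · have hJ : rotJ = rot 0 (- -1) := by rw [rotJ_eq_rot, neg_neg]
    have hA' : (rsvd22 F opt A B C).A' =
        F.matMul₃ opt.leftFirst (rot 0 (- -1))ᵀ A (rot 0 (- -1)) := by
      rw [rsvd22, if_pos hs, ← hJ]; rfl
    have hb := abs_matMul₃_sub_le hu opt.leftFirst A (cp := 0) (sp := -1) (cq := 0) (sq := -1)
      (by norm_num) (by norm_num) (RelNear.refl hw (by norm_num) _)
      (RelNear.refl hw (by norm_num) _) (RelNear.refl hw (by norm_num) _)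
      (RelNear.refl hw (by norm_num) _)
    rw [← hA'] at hb
    have ho : rot 0 (- -1) ∈ Matrix.orthogonalGroup (Fin 2) ℝ :=
      rot_mem_orthogonalGroup (by norm_num)
    obtain ⟨P, hP, Q, hQ, δA, h1, h2⟩ := exists_backward_error (Unitary.star_mem ho) ho
      (hb 0 0) (hb 0 1) (hb 1 0) (hb 1 1)
    exact ⟨P, hP, Q, hQ, δA, h1, h2.trans (by nlinarith)⟩
  · obtain ⟨U, V, U', V', hfin, nU, nV, hdiag⟩ :=
      rsvd22_eq_finish (by linarith : F.u ≤ 1 / 1000) opt A B C hs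
    obtain ⟨At, Bt, Ct, nA, nB, nC, hM⟩ := FloatArith.prodM_near hu1 A B C hA10 hB10 hC10
    rw [hfin] at hη ⊢
    rw [hM] at hdiag
    obtain ⟨cp, sp, cq, sq, p, q, hp, hq, np, np', nq, nq', hA', hann⟩ :=
      rsvd22Finish_spec opt hB10 nA nB nC nU nV hdiag hη hsmall
    have hb := abs_matMul₃_sub_le hu opt.leftFirst A hp hq np np' nq nq'
    have hoP : rot cp (-sp) ∈ Matrix.orthogonalGroup (Fin 2) ℝ :=
      rot_mem_orthogonalGroup (by rwa [neg_sq])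
    have hoQ : rot cq (-sq) ∈ Matrix.orthogonalGroup (Fin 2) ℝ :=
      rot_mem_orthogonalGroup (by rwa [neg_sq])
    rw [hA']
    obtain ⟨P, hP, Q, hQ, δA, h1, h2⟩ := exists_backward_error (A := A)
      (P := (rot cp (-sp))ᵀ)
      (X := zeroEntry (F.matMul₃ opt.leftFirst (rot p.1 (-p.2))ᵀ A (rot q.1 (-q.2))) 0 1)
      (ε₁ := 272 * F.u * η * ‖A‖) (Unitary.star_mem hoP) hoQ
      (by simpa [zeroEntry] using hb 0 0)
      (by simpa [zeroEntry] using hann)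
      (by simpa [zeroEntry] using hb 1 0)
      (by simpa [zeroEntry] using hb 1 1)
    exact ⟨P, hP, Q, hQ, δA, h1, h2.trans (by nlinarith)⟩
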